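/- Let $T\subset\mathbb{R}^2$ be a nondegenerate triangle with longest edge $h_T$ and inscribed circle of diameter $\rho_T$, and let $\varrho_T=h_T/\rho_T$ be its aspect ratio. For $\delta>0$, $T$ satisfies the large angle condition $LAC(\delta)$ if all three angles of $T$ are less than $\pi-\delta$. Let $T^{ct}=\{K_1,K_2,K_3\}$ be the Clough–Tocher split of $T$ at its barycenter, i.e. the three triangles obtained by connecting the barycenter to the vertices of $T$. Let $\mathring{\boldsymbol{\mathcal P}}_2^c(T^{ct})$ be the space of vector fields $v\in H_0^1(\operatorname{int} T)^2$ whose two components are polynomials of degree at most $2$ on each $K_i$. **Lemma.** For every $\delta>0$ there is a constant $C>0$, depending only on $\delta$, such that for every triangle $T$ satisfying $LAC(\delta)$, $$\|\nabla v\|_{L^2(T)}\le C\,\varrho_T\,\|\operatorname{div} v\|_{L^2(T)}\qquad\text{for all } v\in\mathring{\boldsymbol{\mathcal P}}_2^c(T^{ct}).$$ -/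

import Mathlib

open scoped ContDiff
open MeasureTheory Filter Topology

noncomputable section

/-- The Euclidean plane. -/
abbrev Plane : Type := EuclideanSpace ℝ (Fin 2)

/-! ### Sobolev spaces on a plane domain -/

/-- The classical partial derivative `∂φ/∂x_j`. -/
def partialD (j : Fin 2) (φ : Plane → ℝ) (x : Plane) : ℝ :=
  fderiv ℝ φ x (EuclideanSpace.single j 1)

/-- `φ ∈ C_c^∞(D)`. -/
def IsTestFun (D : Set Plane) (φ : Plane → ℝ) : Prop :=
  ContDiff ℝ ∞ φ ∧ HasCompactSupport φ ∧ tsupport φ ⊆ D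

/-- `g` is the weak partial derivative `∂u/∂x_j` on `D`. -/
def IsWeakPartial (D : Set Plane) (j : Fin 2) (u g : Plane → ℝ) : Prop :=
  LocallyIntegrableOn u D ∧ LocallyIntegrableOn g D ∧
    ∀ φ : Plane → ℝ, IsTestFun D φ →
      ∫ x in D, u x * partialD j φ x = -∫ x in D, g x * φ x

/-- `f ∈ L²(D)`. -/
def MemL2 (D : Set Plane) (f : Plane → ℝ) : Prop :=
  MemLp f 2 (volume.restrict D)

/-- `u ∈ H¹(D)`: `u` and its weak partial derivatives lie in `L²(D)`. -/
def MemH1 (D : Set Plane) (u : Plane → ℝ) : Prop :=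
  MemL2 D u ∧ ∀ j : Fin 2, ∃ g : Plane → ℝ, MemL2 D g ∧ IsWeakPartial D j u g

/-- `u ∈ H₀¹(D)`: `u ∈ H¹(D)` is a limit of functions of `C_c^∞(D)` in the norm of `H¹(D)`. -/
def MemH10 (D : Set Plane) (u : Plane → ℝ) : Prop :=
  MemH1 D u ∧ ∃ φ : ℕ → Plane → ℝ, (∀ n, IsTestFun D (φ n)) ∧
    Tendsto (fun n => eLpNorm (fun x => φ n x - u x) 2 (volume.restrict D)) atTop (𝓝 0) ∧
    ∀ (j : Fin 2) (g : Plane → ℝ), IsWeakPartial D j u g →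
      Tendsto (fun n => eLpNorm (fun x => partialD j (φ n) x - g x) 2 (volume.restrict D))
        atTop (𝓝 0)

/-! ### Piecewise polynomial spaces on a triangulation -/

/-- The domain `D = int ⋃_{K ∈ S} closure K` of a triangulation `S`. -/
def meshDomain (S : Set (Set Plane)) : Set Plane :=
  interior (⋃ K ∈ S, closure K)

/-- `q ∈ P_k(S)`: `q ∈ L²(D)` is on each `K ∈ S` a polynomial of degree at most `k`. -/
def IsPiecewisePoly (k : ℕ) (S : Set (Set Plane)) (q : Plane → ℝ) : Prop :=
  MemL2 (meshDomain S) q ∧ ∀ K ∈ S, ∃ p : MvPolynomial (Fin 2) ℝ, p.totalDegree ≤ k ∧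
    ∀ᵐ x ∂(volume.restrict K), q x = MvPolynomial.eval (fun i => x i) p

/-- The vector-valued space of continuous (that is, `H¹`-conforming) piecewise polynomials of
degree at most `k` with zero boundary values: each component lies in `P_k(S) ∩ H₀¹(D)`. -/
def pwPolyZero (k : ℕ) (S : Set (Set Plane)) : Set (Plane → Plane) :=
  {v | ∀ i : Fin 2, IsPiecewisePoly k S (fun x => v x i) ∧
    MemH10 (meshDomain S) (fun x => v x i)}

/-- `G` is the weak gradient of the vector field `v` on `D`, `G i j = ∂v_i/∂x_j`. -/
def IsWeakGradient (D : Set Plane) (v : Plane → Plane) (G : Fin 2 → Fin 2 → Plane → ℝ) : Prop :=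
  ∀ i j : Fin 2, IsWeakPartial D j (fun x => v x i) (G i j)

/-- `‖∇v‖_{L²(A)}` for a vector field `v` with gradient `G`. -/
def gradL2Norm (A : Set Plane) (G : Fin 2 → Fin 2 → Plane → ℝ) : ℝ :=
  √(∫ x in A, ∑ i, ∑ j, G i j x ^ 2)

/-- `‖div v‖_{L²(A)}` for a vector field `v` with gradient `G`. -/
def divL2Norm (A : Set Plane) (G : Fin 2 → Fin 2 → Plane → ℝ) : ℝ :=
  √(∫ x in A, (∑ i, G i i x) ^ 2)

/-! ### Triangles -/

/-- The length `h_T` of the longest edge of `T`. -/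
def longestEdge (T : Affine.Triangle ℝ Plane) : ℝ :=
  max (dist (T.points 0) (T.points 1))
    (max (dist (T.points 1) (T.points 2)) (dist (T.points 2) (T.points 0)))

/-- The aspect ratio: longest edge divided by the diameter of the inscribed circle. -/
def aspectRatio (T : Affine.Triangle ℝ Plane) : ℝ :=
  longestEdge T / (2 * T.inradius)

/-- The large angle condition `LAC(δ)`: every angle of `T` is less than `π - δ`. -/
def LargeAngleCond (δ : ℝ) (T : Affine.Triangle ℝ Plane) : Prop :=
  ∀ i : Fin 3,
    EuclideanGeometry.angle (T.points (i + 1)) (T.points i) (T.points (i + 2)) < Real.pi - δ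

/-- The Clough-Tocher split of `T` at `z`: the three triangles obtained by replacing one vertex
of `T` by `z`. -/
def cloughTocher (T : Affine.Triangle ℝ Plane) (z : Plane) : Set (Set Plane) :=
  Set.range fun i : Fin 3 => convexHull ℝ (Set.range (Function.update T.points i z))

end

/-! Write `λ_i` for the barycentric coordinates and `b_i` for the vertices. The closed cell `K_i`
that omits `b_i` is the part of the triangle where `λ_i` is the smallest coordinate.

Normal form. Since `∑ λ_m = 1`, a polynomial of degree at most 2 is a quadratic form in the `λ_m`.
Vanishing on the outer edge makes the piece on `K_i` divisible by `λ_i`, and matching along the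
medians glues the cofactors. So each component of `v` equals `λ_i (∑ β_m λ_m + a λ_i)` on `K_i`,
with `β` and `a` common to all cells (`exists_ct_form`). The vanishing and the matching come from
`H₀¹`: the zero extension has weak derivatives on the whole plane, and these exclude jumps across a
line (`trace_eq`).

Algebra. Now let `β_m` and `a` be the vectors formed from both components. On `K_i` the divergence
is a linear form in the `λ_m`. Its coefficient at `m ≠ i` is `β_m · ∇λ_i`, and its coefficient at
`i` also contains `2 a · ∇λ_i`. As `∑ ∇λ_q = 0`, these coefficients bound every `β_m · ∇λ_q` and `a
· ∇λ_q` with absolute constants (`coeff_le_of_div_coeff_le`).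

Geometry. Expanding a vector along two edges at a vertex `b_k` has these products as coefficients,
so the entries of `∇v` cost only the factor (edge at `b_k`) times `|∇λ_q|`. The vertex is chosen
with the sine of its angle at least some `σ(δ) > 0`. Cramer's rule and the comparison of edges by
the aspect ratio then bound the factor by a multiple of `ϱ_T / σ` (`abs_edge_mul_grad_le`).

Integration. On each cell the squared divergence coefficients times the area of the triangle are
bounded by `∫ (div v)²` (`volume_mul_sq_coeff_le`), which turns the pointwise bound into the `L²`
bound. -/

/-! ### Affine charts and change of variables -/

/-- The affine chart `y ↦ x₀ + L y` of the plane. -/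
def affChart (x₀ : Plane) (L : (ℝ × ℝ) ≃L[ℝ] Plane) : (ℝ × ℝ) ≃ₜ Plane :=
  L.toHomeomorph.trans (Homeomorph.addLeft x₀)

@[simp] lemma affChart_apply (x₀ : Plane) (L : (ℝ × ℝ) ≃L[ℝ] Plane) (y : ℝ × ℝ) :
    affChart x₀ L y = x₀ + L y := rfl

/-- Uniqueness of Haar measure up to scaling. The constant `c` is the Jacobian of the chart, whose
explicit value is never needed. -/
lemma exists_map_affChart (x₀ : Plane) (L : (ℝ × ℝ) ≃L[ℝ] Plane) :
    ∃ c : NNReal, c ≠ 0 ∧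
      (volume : Measure Plane) = c • Measure.map (affChart x₀ L) (volume : Measure (ℝ × ℝ)) := by
  have h1 : (Measure.map L (volume : Measure (ℝ × ℝ))).IsAddHaarMeasure :=
    L.isAddHaarMeasure_map _
  have h2 : Measure.map (affChart x₀ L) (volume : Measure (ℝ × ℝ))
      = Measure.map L (volume : Measure (ℝ × ℝ)) := by
    have : (affChart x₀ L : ℝ × ℝ → Plane) = (fun x => x₀ + x) ∘ L := rfl
    rw [this, ← Measure.map_map (by fun_prop) (by fun_prop), map_add_left_eq_self]
  rw [h2]
  refine ⟨Measure.addHaarScalarFactor volume (Measure.map L volume),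
    (Measure.addHaarScalarFactor_pos_of_isAddHaarMeasure _ _).ne', ?_⟩
  exact Measure.isAddLeftInvariant_eq_smul _ _

lemma ae_affChart (x₀ : Plane) (L : (ℝ × ℝ) ≃L[ℝ] Plane) {P : Plane → Prop}
    (h : ∀ᵐ x, P x) : ∀ᵐ y : ℝ × ℝ, P (affChart x₀ L y) := by
  obtain ⟨c, hc, hv⟩ := exists_map_affChart x₀ L
  rw [hv] at h
  have h' : ∀ᵐ x ∂(Measure.map (affChart x₀ L) (volume : Measure (ℝ × ℝ))), P x := by
    refine Measure.AbsolutelyContinuous.ae_le ?_ h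
    refine Measure.AbsolutelyContinuous.mk fun s _ hs => ?_
    simpa [hc] using hs
  exact ae_of_ae_map (affChart x₀ L).continuous.aemeasurable h'

lemma hasFDerivAt_affChart (x₀ : Plane) (L : (ℝ × ℝ) ≃L[ℝ] Plane) (y : ℝ × ℝ) :
    HasFDerivAt (affChart x₀ L) (L : (ℝ × ℝ) →L[ℝ] Plane) y :=
  (L.hasFDerivAt (x := y)).const_add x₀

lemma contDiff_affChart (x₀ : Plane) (L : (ℝ × ℝ) ≃L[ℝ] Plane) :
    ContDiff ℝ ∞ (affChart x₀ L) :=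
  contDiff_const.add L.contDiff

lemma contDiff_affChart_symm (x₀ : Plane) (L : (ℝ × ℝ) ≃L[ℝ] Plane) :
    ContDiff ℝ ∞ (affChart x₀ L).symm :=
  L.symm.contDiff.comp (contDiff_const.add contDiff_id)

lemma fderiv_comp_affChart (x₀ : Plane) (L : (ℝ × ℝ) ≃L[ℝ] Plane) {p : Plane → ℝ}
    (hp : Differentiable ℝ p) (y w : ℝ × ℝ) :
    fderiv ℝ (p ∘ affChart x₀ L) y w = fderiv ℝ p (affChart x₀ L y) (L w) := by
  rw [((hp _).hasFDerivAt.comp y (hasFDerivAt_affChart x₀ L y)).fderiv]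
  rfl

/-! ### Traces from the two sides of a straight interface -/

lemma deriv_slice {F : ℝ × ℝ → ℝ} (hF : Differentiable ℝ F) (s t : ℝ) :
    deriv (fun t => F (s, t)) t = fderiv ℝ F (s, t) (0, 1) := by
  have h : HasDerivAt (fun t : ℝ => (s, t)) ((0 : ℝ), (1 : ℝ)) t :=
    (hasDerivAt_const t s).prodMk (hasDerivAt_id t)
  exact ((hF (s, t)).hasFDerivAt.comp_hasDerivAt t h).deriv

lemma hasCompactSupport_slice {F : ℝ × ℝ → ℝ} (hF : HasCompactSupport F) (s : ℝ) :
    HasCompactSupport fun t => F (s, t) := by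
  refine HasCompactSupport.intro (hF.isCompact.image continuous_snd) fun t ht => ?_
  by_contra h
  exact ht ⟨(s, t), subset_tsupport _ h, rfl⟩

lemma contDiff_slice {F : ℝ × ℝ → ℝ} (hF : ContDiff ℝ 1 F) (s : ℝ) :
    ContDiff ℝ 1 fun t => F (s, t) := by fun_prop

lemma integrable_fderiv_apply {E : Type*} [NormedAddCommGroup E] [NormedSpace ℝ E]
    [FiniteDimensional ℝ E] [MeasurableSpace E] [BorelSpace E] {μ : Measure E}
    [IsFiniteMeasureOnCompacts μ] {F : E → ℝ} (hF : ContDiff ℝ 1 F)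
    (hc : HasCompactSupport F) (w : E) : Integrable (fun y => fderiv ℝ F y w) μ := by
  refine Continuous.integrable_of_hasCompactSupport ?_ ?_
  · exact (hF.continuous_fderiv one_ne_zero).clm_apply continuous_const
  · exact hc.fderiv_apply (𝕜 := ℝ) w

lemma setIntegral_fderiv_upper {F : ℝ × ℝ → ℝ} (hF : ContDiff ℝ 1 F)
    (hc : HasCompactSupport F) :
    ∫ y in Set.univ ×ˢ Set.Ioi (0 : ℝ), fderiv ℝ F y (0, 1) = -∫ s, F (s, 0) := by
  rw [Measure.volume_eq_prod,
    setIntegral_prod _ (integrable_fderiv_apply hF hc _).integrableOn, Measure.restrict_univ,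
    ← integral_neg]
  congr 1 with s
  simp_rw [← deriv_slice (hF.differentiable one_ne_zero)]
  exact (hasCompactSupport_slice hc s).integral_Ioi_deriv_eq (contDiff_slice hF s) 0

lemma setIntegral_fderiv_lower {F : ℝ × ℝ → ℝ} (hF : ContDiff ℝ 1 F)
    (hc : HasCompactSupport F) :
    ∫ y in Set.univ ×ˢ Set.Iic (0 : ℝ), fderiv ℝ F y (0, 1) = ∫ s, F (s, 0) := by
  rw [Measure.volume_eq_prod,
    setIntegral_prod _ (integrable_fderiv_apply hF hc _).integrableOn, Measure.restrict_univ]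
  congr 1 with s
  simp_rw [← deriv_slice (hF.differentiable one_ne_zero)]
  exact (hasCompactSupport_slice hc s).integral_Iic_deriv_eq (contDiff_slice hF s) 0

lemma ae_snd_ne_zero : ∀ᵐ y : ℝ × ℝ, y.2 ≠ 0 := by
  have h : ∀ᵐ t : ℝ, t ≠ 0 := by simp [ae_iff]
  exact Measure.quasiMeasurePreserving_snd.ae h

lemma fderiv_apply_eq_zero_of_notMem_tsupport {E : Type*} [NormedAddCommGroup E] [NormedSpace ℝ E]
    {φ : E → ℝ} {y : E} (hy : y ∉ tsupport φ) (w : E) : fderiv ℝ φ y w = 0 := by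
  have := (notMem_tsupport_iff_eventuallyEq.1 hy).fderiv_eq (𝕜 := ℝ)
  rw [this]
  simp

/-- A weak derivative across a straight interface forbids jumps: tested form. -/
lemma integral_jump_eq_zero {U H P Q : ℝ × ℝ → ℝ} (hP : ContDiff ℝ 1 P) (hQ : ContDiff ℝ 1 Q)
    {a b r : ℝ} {φ : ℝ × ℝ → ℝ} (hφ : ContDiff ℝ 1 φ) (hc : HasCompactSupport φ)
    (hs : tsupport φ ⊆ Set.Ioo a b ×ˢ Set.Ioo (-r) r)
    (hw : ∫ y, (U y * fderiv ℝ φ y (0, 1) + H y * φ y) = 0)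
    (hpos : ∀ᵐ y, y ∈ Set.Ioo a b ×ˢ Set.Ioo 0 r → U y = P y ∧ H y = fderiv ℝ P y (0, 1))
    (hneg : ∀ᵐ y, y ∈ Set.Ioo a b ×ˢ Set.Ioo (-r) 0 → U y = Q y ∧ H y = fderiv ℝ Q y (0, 1)) :
    ∫ s, φ (s, 0) * (P (s, 0) - Q (s, 0)) = 0 := by
  have mul_deriv : ∀ R : ℝ × ℝ → ℝ, ContDiff ℝ 1 R → ∀ y,
      fderiv ℝ (fun y => R y * φ y) y (0, 1)
        = R y * fderiv ℝ φ y (0, 1) + fderiv ℝ R y (0, 1) * φ y := by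
    intro R hR y
    rw [fderiv_fun_mul (hR.differentiable one_ne_zero y) (hφ.differentiable one_ne_zero y)]
    simp [mul_comm]
  have hPφ : ContDiff ℝ 1 fun y => P y * φ y := hP.mul hφ
  have hQφ : ContDiff ℝ 1 fun y => Q y * φ y := hQ.mul hφ
  have hPc : HasCompactSupport fun y => P y * φ y := hc.mul_left
  have hQc : HasCompactSupport fun y => Q y * φ y := hc.mul_left
  set A : Set (ℝ × ℝ) := Set.univ ×ˢ Set.Ioi (0 : ℝ) with hA
  set B : Set (ℝ × ℝ) := Set.univ ×ˢ Set.Iic (0 : ℝ) with hB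
  have hAm : MeasurableSet A := MeasurableSet.univ.prod measurableSet_Ioi
  have hBm : MeasurableSet B := MeasurableSet.univ.prod measurableSet_Iic
  -- By the product rule the integrand is the normal derivative of `P φ` above the line and of `Q φ`
  -- below it. Integrating in the normal direction leaves only the boundary terms on the line.
  have hae : ∀ᵐ y, U y * fderiv ℝ φ y (0, 1) + H y * φ y
      = A.indicator (fun y => fderiv ℝ (fun y => P y * φ y) y (0, 1)) y
        + B.indicator (fun y => fderiv ℝ (fun y => Q y * φ y) y (0, 1)) y := by
    filter_upwards [hpos, hneg, ae_snd_ne_zero] with y h1 h2 h3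
    by_cases hy : y ∈ tsupport φ
    · obtain ⟨hy1, hy2⟩ := hs hy
      rcases lt_or_gt_of_ne h3 with h | h
      · have hyA : y ∉ A := fun hh => absurd hh.2 (not_lt.2 h.le)
        have hyB : y ∈ B := ⟨trivial, h.le⟩
        obtain ⟨e1, e2⟩ := h2 ⟨hy1, hy2.1, h⟩
        rw [Set.indicator_of_notMem hyA, Set.indicator_of_mem hyB, mul_deriv Q hQ, e1, e2, zero_add]
      · have hyA : y ∈ A := ⟨trivial, h⟩
        have hyB : y ∉ B := fun hh => absurd hh.2 (not_le.2 h)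
        obtain ⟨e1, e2⟩ := h1 ⟨hy1, h, hy2.2⟩
        rw [Set.indicator_of_mem hyA, Set.indicator_of_notMem hyB, mul_deriv P hP, e1, e2, add_zero]
    · have e0 : φ y = 0 := image_eq_zero_of_notMem_tsupport hy
      have e1 := fderiv_apply_eq_zero_of_notMem_tsupport hy ((0 : ℝ), (1 : ℝ))
      simp only [Set.indicator_apply, mul_deriv P hP, mul_deriv Q hQ, e0, e1]
      simp
  rw [integral_congr_ae hae, integral_add
    ((integrable_fderiv_apply hPφ hPc _).indicator hAm)
    ((integrable_fderiv_apply hQφ hQc _).indicator hBm), integral_indicator hAm,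
    integral_indicator hBm, setIntegral_fderiv_upper hPφ hPc, setIntegral_fderiv_lower hQφ hQc] at hw
  have i1 : Integrable fun s => P (s, 0) * φ (s, 0) := by
    refine Continuous.integrable_of_hasCompactSupport (by fun_prop) ?_
    refine HasCompactSupport.intro (hPc.isCompact.image continuous_fst) fun s hs' => ?_
    by_contra h
    exact hs' ⟨(s, 0), subset_tsupport _ h, rfl⟩
  have i2 : Integrable fun s => Q (s, 0) * φ (s, 0) := by
    refine Continuous.integrable_of_hasCompactSupport (by fun_prop) ?_
    refine HasCompactSupport.intro (hQc.isCompact.image continuous_fst) fun s hs' => ?_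
    by_contra h
    exact hs' ⟨(s, 0), subset_tsupport _ h, rfl⟩
  have : ∀ s, φ (s, 0) * (P (s, 0) - Q (s, 0)) = P (s, 0) * φ (s, 0) - Q (s, 0) * φ (s, 0) :=
    fun s => by ring
  simp_rw [this]
  rw [integral_sub i1 i2]
  linarith

lemma tsupport_tensor_subset {α β : ℝ → ℝ} :
    tsupport (fun y : ℝ × ℝ => α y.1 * β y.2) ⊆ tsupport α ×ˢ tsupport β := by
  refine closure_minimal ?_ ((isClosed_tsupport α).prod (isClosed_tsupport β))
  intro y hy
  have : α y.1 * β y.2 ≠ 0 := hy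
  exact ⟨subset_tsupport _ (left_ne_zero_of_mul this), subset_tsupport _ (right_ne_zero_of_mul this)⟩

/-- Testing with products `α(s) β(t)`, where `β 0 = 1`, reduces the jump identity to the fundamental
lemma of the calculus of variations on the interval; continuity removes the exceptional null set. -/
lemma eq_on_interface {U H P Q : ℝ × ℝ → ℝ} (hP : ContDiff ℝ 1 P) (hQ : ContDiff ℝ 1 Q)
    {a b r : ℝ} (hr : 0 < r)
    (hw : ∀ φ : ℝ × ℝ → ℝ, ContDiff ℝ ∞ φ → HasCompactSupport φ →
      ∫ y, (U y * fderiv ℝ φ y (0, 1) + H y * φ y) = 0)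
    (hpos : ∀ᵐ y, y ∈ Set.Ioo a b ×ˢ Set.Ioo 0 r → U y = P y ∧ H y = fderiv ℝ P y (0, 1))
    (hneg : ∀ᵐ y, y ∈ Set.Ioo a b ×ˢ Set.Ioo (-r) 0 → U y = Q y ∧ H y = fderiv ℝ Q y (0, 1)) :
    ∀ s ∈ Set.Ioo a b, P (s, 0) = Q (s, 0) := by
  let β : ContDiffBump (0 : ℝ) := ⟨r / 4, r / 2, by positivity, by linarith⟩
  have hβ0 : β 0 = 1 := β.one_of_mem_closedBall (by simp [β]; positivity)
  have hβs : tsupport β ⊆ Set.Ioo (-r) r := by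
    rw [β.tsupport_eq, Real.closedBall_eq_Icc]
    intro t ht
    simp only [β, Set.mem_Icc] at ht
    exact ⟨by linarith, by linarith⟩
  have hcont : Continuous fun s : ℝ => P (s, 0) - Q (s, 0) := by
    have := hP.continuous
    have := hQ.continuous
    fun_prop
  have key := isOpen_Ioo.ae_eq_zero_of_integral_contDiff_smul_eq_zero
    (μ := volume) (U := Set.Ioo a b) (f := fun s : ℝ => P (s, 0) - Q (s, 0))
    (hcont.locallyIntegrable.locallyIntegrableOn _) (by
      intro α hα hαc hαs
      have hφ : ContDiff ℝ ∞ fun y : ℝ × ℝ => α y.1 * β y.2 :=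
        (hα.comp contDiff_fst).mul (β.contDiff.comp contDiff_snd)
      have hφc : HasCompactSupport fun y : ℝ × ℝ => α y.1 * β y.2 :=
        (hαc.isCompact.prod β.hasCompactSupport.isCompact).of_isClosed_subset
          (isClosed_tsupport _) tsupport_tensor_subset
      have := integral_jump_eq_zero hP hQ (hφ.of_le (by simp)) hφc
        (tsupport_tensor_subset.trans (Set.prod_mono hαs hβs)) (hw _ hφ hφc) hpos hneg
      simpa [hβ0] using this)
  have h0 : Set.EqOn (fun s : ℝ => P (s, 0) - Q (s, 0)) (fun _ => 0) (Set.Ioo a b) := by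
    refine Measure.eqOn_open_of_ae_eq (μ := volume) ?_ isOpen_Ioo hcont.continuousOn
      continuousOn_const
    exact (ae_restrict_iff' measurableSet_Ioo).2 key
  intro s hs
  exact sub_eq_zero.1 (h0 hs)

/-- A function with a weak derivative transversal to a line that is smooth on both sides of the
line has equal traces from both sides. -/
lemma trace_eq {U H : Plane → ℝ} {x₀ : Plane} {L : (ℝ × ℝ) ≃L[ℝ] Plane}
    (hw : ∀ φ : Plane → ℝ, ContDiff ℝ ∞ φ → HasCompactSupport φ →
      ∫ x, (U x * fderiv ℝ φ x (L (0, 1)) + H x * φ x) = 0)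
    {p q : Plane → ℝ} (hp : ContDiff ℝ 1 p) (hq : ContDiff ℝ 1 q) {A B : Set Plane}
    (hA : ∀ᵐ x, x ∈ A → U x = p x ∧ H x = fderiv ℝ p x (L (0, 1)))
    (hB : ∀ᵐ x, x ∈ B → U x = q x ∧ H x = fderiv ℝ q x (L (0, 1)))
    {a b r : ℝ} (hr : 0 < r)
    (hpos : ∀ s t, s ∈ Set.Ioo a b → t ∈ Set.Ioo 0 r → x₀ + L (s, t) ∈ A)
    (hneg : ∀ s t, s ∈ Set.Ioo a b → t ∈ Set.Ioo (-r) 0 → x₀ + L (s, t) ∈ B) :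
    ∀ s ∈ Set.Ioo a b, p (x₀ + L (s, 0)) = q (x₀ + L (s, 0)) := by
  set Ψ := affChart x₀ L with hΨ
  have hΨd : ContDiff ℝ 1 Ψ := (contDiff_affChart x₀ L).of_le (by simp)
  refine eq_on_interface (U := U ∘ Ψ) (H := H ∘ Ψ) (P := p ∘ Ψ) (Q := q ∘ Ψ)
    (hp.comp hΨd) (hq.comp hΨd) hr ?_ ?_ ?_
  · intro φ hφ hφc
    have hφ' : ContDiff ℝ ∞ (φ ∘ Ψ.symm) := hφ.comp (contDiff_affChart_symm x₀ L)
    have h := hw (φ ∘ Ψ.symm) hφ' (hφc.comp_homeomorph Ψ.symm)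
    obtain ⟨c, hc, hv⟩ := exists_map_affChart x₀ L
    rw [hv, integral_smul_nnreal_measure, Ψ.measurableEmbedding.integral_map] at h
    have h' := (smul_eq_zero.1 h).resolve_left hc
    refine Eq.trans ?_ h'
    congr 1 with y
    have e1 : (φ ∘ Ψ.symm) ∘ affChart x₀ L = φ :=
      funext fun z => congrArg φ (Ψ.symm_apply_apply z)
    have e2 := fderiv_comp_affChart x₀ L (hφ'.differentiable (by simp)) y (0, 1)
    rw [e1] at e2
    rw [e2, Function.comp_apply, Function.comp_apply, Function.comp_apply, Ψ.symm_apply_apply]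
  · filter_upwards [ae_affChart x₀ L hA] with y hy hmem
    rw [fderiv_comp_affChart x₀ L (hp.differentiable one_ne_zero)]
    exact hy (hpos y.1 y.2 hmem.1 hmem.2)
  · filter_upwards [ae_affChart x₀ L hB] with y hy hmem
    rw [fderiv_comp_affChart x₀ L (hq.differentiable one_ne_zero)]
    exact hy (hneg y.1 y.2 hmem.1 hmem.2)

/-! ### Weak derivatives and extension by zero of `H₀¹` functions -/

lemma tendsto_integral_mul_of_eLpNorm {α : Type*} [MeasurableSpace α] {μ : Measure α}
    {f : ℕ → α → ℝ} {u ψ : α → ℝ} (hf : ∀ n, MemLp (f n) 2 μ) (hu : MemLp u 2 μ)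
    (hψ : MemLp ψ 2 μ) (h : Tendsto (fun n => eLpNorm (fun x => f n x - u x) 2 μ) atTop (𝓝 0)) :
    Tendsto (fun n => ∫ x, f n x * ψ x ∂μ) atTop (𝓝 (∫ x, u x * ψ x ∂μ)) := by
  have hint : ∀ v : α → ℝ, MemLp v 2 μ → Integrable (fun x => v x * ψ x) μ :=
    fun v hv => MemLp.integrable_mul hv hψ
  refine tendsto_integral_of_L1' _ (hint u hu).aestronglyMeasurable
    (Eventually.of_forall fun n => hint _ (hf n)) ?_
  have hb : ∀ n, eLpNorm ((fun x => f n x * ψ x) - fun x => u x * ψ x) 1 μ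
      ≤ eLpNorm (fun x => f n x - u x) 2 μ * eLpNorm ψ 2 μ := by
    intro n
    have e : ((fun x => f n x * ψ x) - fun x => u x * ψ x) = (fun x => f n x - u x) • ψ := by
      ext x; simp [sub_mul]
    rw [e]
    exact eLpNorm_smul_le_mul_eLpNorm hψ.aestronglyMeasurable
      ((hf n).sub hu).aestronglyMeasurable
  have hlim : Tendsto (fun n => eLpNorm (fun x => f n x - u x) 2 μ * eLpNorm ψ 2 μ) atTop (𝓝 0) := by
    have := ENNReal.Tendsto.mul_const (b := eLpNorm ψ 2 μ) h (Or.inr hψ.eLpNorm_ne_top)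
    simpa using this
  exact tendsto_of_tendsto_of_tendsto_of_le_of_le tendsto_const_nhds hlim (fun _ => zero_le) hb

lemma partialD_eq_zero_of_notMem {φ : Plane → ℝ} {x : Plane} (hx : x ∉ tsupport φ) (j : Fin 2) :
    partialD j φ x = 0 :=
  fderiv_apply_eq_zero_of_notMem_tsupport hx _

lemma contDiff_partialD {φ : Plane → ℝ} (h : ContDiff ℝ ∞ φ) (j : Fin 2) :
    ContDiff ℝ ∞ (partialD j φ) :=
  (h.fderiv_right (m := ∞) (by simp)).clm_apply contDiff_const

lemma hasCompactSupport_partialD {φ : Plane → ℝ} (h : HasCompactSupport φ) (j : Fin 2) :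
    HasCompactSupport (partialD j φ) :=
  h.fderiv_apply (𝕜 := ℝ) _

/-- Integration by parts against a compactly supported smooth function. -/
lemma integral_mul_partialD {f φ : Plane → ℝ} (hf : ContDiff ℝ ∞ f) (hφ : ContDiff ℝ ∞ φ)
    (hc : HasCompactSupport φ) (j : Fin 2) :
    ∫ x, f x * partialD j φ x = -∫ x, partialD j f x * φ x := by
  have hφ' := contDiff_partialD hφ j
  have hf' := contDiff_partialD hf j
  refine integral_mul_fderiv_eq_neg_fderiv_mul_of_integrable ?_ ?_ ?_
    (fun x _ => hf.differentiable (by simp) x) (fun x _ => hφ.differentiable (by simp) x)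
  · exact (hf'.continuous.mul hφ.continuous).integrable_of_hasCompactSupport hc.mul_left
  · exact (hf.continuous.mul hφ'.continuous).integrable_of_hasCompactSupport
      (hasCompactSupport_partialD hc j).mul_left
  · exact (hf.continuous.mul hφ.continuous).integrable_of_hasCompactSupport hc.mul_left

/-- The extension by zero of an `H₀¹` function has a weak derivative on the whole plane. -/
lemma MemH10.integral_mul_partialD_eq {D : Set Plane} {u g : Plane → ℝ} {j : Fin 2}
    (hu : MemH10 D u) (hg : MemL2 D g) (hw : IsWeakPartial D j u g) {φ : Plane → ℝ}
    (hφ : ContDiff ℝ ∞ φ) (hc : HasCompactSupport φ) :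
    ∫ x in D, u x * partialD j φ x = -∫ x in D, g x * φ x := by
  obtain ⟨⟨hu2, -⟩, f, hf, hfu, hfg⟩ := hu
  have hφ2 : MemLp φ 2 (volume.restrict D) :=
    (hφ.continuous.memLp_of_hasCompactSupport hc).restrict D
  have hφ'2 : MemLp (partialD j φ) 2 (volume.restrict D) :=
    ((contDiff_partialD hφ j).continuous.memLp_of_hasCompactSupport
      (hasCompactSupport_partialD hc j)).restrict D
  have h1 := tendsto_integral_mul_of_eLpNorm (μ := volume.restrict D)
    (fun n => ((hf n).1.continuous.memLp_of_hasCompactSupport (hf n).2.1).restrict D) hu2 hφ'2 hfu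
  have h2 := tendsto_integral_mul_of_eLpNorm (μ := volume.restrict D)
    (fun n => ((contDiff_partialD (hf n).1 j).continuous.memLp_of_hasCompactSupport
      (hasCompactSupport_partialD (hf n).2.1 j)).restrict D) hg hφ2 (hfg j g hw)
  -- The approximants have compact support in `D`, so their integrals extend to the plane and
  -- integration by parts is valid although `φ` need not vanish on the boundary of `D`.
  refine tendsto_nhds_unique h1 (h2.neg.congr fun n => ?_)
  rw [setIntegral_eq_integral_of_forall_compl_eq_zero,
    setIntegral_eq_integral_of_forall_compl_eq_zero, integral_mul_partialD (hf n).1 hφ hc]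
  · intro x hx
    rw [image_eq_zero_of_notMem_tsupport fun h => hx ((hf n).2.2 h), zero_mul]
  · intro x hx
    rw [partialD_eq_zero_of_notMem fun h => hx ((hf n).2.2 h), zero_mul]

/-- Where a function is smooth, a weak partial derivative is the classical one. -/
lemma IsWeakPartial.ae_eq_partialD {D U : Set Plane} {u g p : Plane → ℝ} {j : Fin 2}
    (hw : IsWeakPartial D j u g) (hU : IsOpen U) (hUD : U ⊆ D) (hp : ContDiff ℝ ∞ p)
    (hup : ∀ᵐ x, x ∈ U → u x = p x) : ∀ᵐ x, x ∈ U → g x = partialD j p x := by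
  have hp' := (contDiff_partialD hp j).continuous
  have hgU : LocallyIntegrableOn g U := hw.2.1.mono_set hUD
  have key := hU.ae_eq_zero_of_integral_contDiff_smul_eq_zero
    (μ := volume) (f := fun x => g x - partialD j p x)
    (hgU.sub (hp'.locallyIntegrable.locallyIntegrableOn _)) (by
      intro φ hφ hc hs
      have hi1 : Integrable fun x => g x * φ x := by
        have h1 : IntegrableOn g (tsupport φ) := hgU.integrableOn_compact_subset hs hc.isCompact
        have h2 := h1.mul_continuousOn hφ.continuous.continuousOn hc.isCompact
        refine (integrableOn_iff_integrable_of_support_subset ?_).1 h2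
        exact (Function.support_mul_subset_right g φ).trans (subset_tsupport φ)
      have hi2 : Integrable fun x => partialD j p x * φ x :=
        (hp'.mul hφ.continuous).integrable_of_hasCompactSupport hc.mul_left
      have e : ∀ x, φ x • (g x - partialD j p x) = g x * φ x - partialD j p x * φ x := by
        intro x; rw [smul_eq_mul]; ring
      simp_rw [e]
      rw [integral_sub hi1 hi2]
      have h1 := hw.2.2 φ ⟨hφ, hc, hs.trans hUD⟩
      rw [setIntegral_eq_integral_of_forall_compl_eq_zero,
        setIntegral_eq_integral_of_forall_compl_eq_zero] at h1
      · have h2 : ∫ x, u x * partialD j φ x = ∫ x, p x * partialD j φ x := by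
          refine integral_congr_ae ?_
          filter_upwards [hup] with x hx
          by_cases hxs : x ∈ tsupport φ
          · simp only [hx (hs hxs)]
          · simp only [partialD_eq_zero_of_notMem hxs, mul_zero]
        rw [h2, integral_mul_partialD hp hφ hc] at h1
        linarith
      · intro x hx
        rw [image_eq_zero_of_notMem_tsupport fun h => hx (hUD (hs h)), mul_zero]
      · intro x hx
        rw [partialD_eq_zero_of_notMem fun h => hx (hUD (hs h)), mul_zero])
  filter_upwards [key] with x hx hxU
  exact sub_eq_zero.1 (hx hxU)

lemma fderiv_apply_eq_sum_partialD (φ : Plane → ℝ) (x d : Plane) :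
    fderiv ℝ φ x d = ∑ j, d j * partialD j φ x := by
  have : d = ∑ j, d j • EuclideanSpace.single j (1 : ℝ) := by
    ext i
    fin_cases i <;> simp [Fin.sum_univ_two]
  conv_lhs => rw [this]
  simp [partialD]

/-- The directional form of `MemH10.integral_mul_partialD_eq`, for the extension by zero. -/
lemma MemH10.exists_weak_directional {D : Set Plane} (hD : MeasurableSet D) {u : Plane → ℝ}
    (hu : MemH10 D u) : ∃ g : Fin 2 → Plane → ℝ, (∀ j, IsWeakPartial D j u (g j)) ∧
      ∀ (d : Plane) (φ : Plane → ℝ), ContDiff ℝ ∞ φ → HasCompactSupport φ →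
        ∫ x, (D.indicator u x * fderiv ℝ φ x d + D.indicator (fun x => ∑ j, d j * g j x) x * φ x)
          = 0 := by
  choose g hg hw using hu.1.2
  refine ⟨g, hw, fun d φ hφ hc => ?_⟩
  have e : ∀ x, D.indicator u x * fderiv ℝ φ x d
      + D.indicator (fun x => ∑ j, d j * g j x) x * φ x
      = D.indicator (fun x => ∑ j, (d j * (u x * partialD j φ x) + d j * (g j x * φ x))) x := by
    intro x
    by_cases hx : x ∈ D
    · simp only [Set.indicator_of_mem hx, fderiv_apply_eq_sum_partialD, Fin.sum_univ_two]
      ring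
    · simp only [Set.indicator_of_notMem hx, zero_mul, add_zero]
  simp_rw [e]
  rw [integral_indicator hD]
  have i1 : ∀ j, Integrable (fun x => u x * partialD j φ x) (volume.restrict D) := fun j =>
    MemLp.integrable_mul (q := 2) hu.1.1 (((contDiff_partialD hφ j).continuous.memLp_of_hasCompactSupport
      (hasCompactSupport_partialD hc j)).restrict D)
  have i2 : ∀ j, Integrable (fun x => g j x * φ x) (volume.restrict D) := fun j =>
    MemLp.integrable_mul (q := 2) (hg j) ((hφ.continuous.memLp_of_hasCompactSupport hc).restrict D)
  have i3 : ∀ j ∈ Finset.univ, Integrable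
      (fun x => d j * (u x * partialD j φ x) + d j * (g j x * φ x)) (volume.restrict D) :=
    fun j _ => ((i1 j).const_mul _).add ((i2 j).const_mul _)
  rw [integral_finsetSum _ i3]
  refine Finset.sum_eq_zero fun j _ => ?_
  rw [integral_add ((i1 j).const_mul _) ((i2 j).const_mul _), integral_const_mul,
    integral_const_mul, hu.integral_mul_partialD_eq (hg j) (hw j) hφ hc]
  ring

/-! ### Cells of the barycentric split -/

/-- The vertices of a triangle as an affine basis of the plane. -/
noncomputable def Affine.Simplex.planeBasis (T : Affine.Triangle ℝ Plane) :
    AffineBasis (Fin 3) ℝ Plane where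
  toFun := T.points
  ind' := T.independent
  tot' := by
    rw [T.independent.affineSpan_eq_top_iff_card_eq_finrank_add_one]
    simp

namespace AffineBasis

variable (b : AffineBasis (Fin 3) ℝ Plane)

/-- The closed cell of the barycentric Clough-Tocher split that omits the vertex `b i`, in barycentric
coordinates. -/
def ctCell (i : Fin 3) : Set Plane := {x | 0 ≤ b.coord i x ∧ ∀ j, b.coord i x ≤ b.coord j x}

lemma coord_add_smul_apply (i : Fin 3) (x d : Plane) (s : ℝ) :
    b.coord i (x + s • d) = b.coord i x + s * (b.coord i).linear d := by
  have := (b.coord i).map_vadd x (s • d)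
  rw [vadd_eq_add, vadd_eq_add, add_comm (s • d)] at this
  rw [this, map_smul, smul_eq_mul, add_comm]

lemma linear_coord_sub (i : Fin 3) (x y : Plane) :
    (b.coord i).linear (x - y) = b.coord i x - b.coord i y := by
  simpa using (b.coord i).linearMap_vsub x y

lemma coe_coord_eq (i : Fin 3) : (b.coord i : Plane → ℝ) =
    fun y => (LinearMap.toContinuousLinearMap (b.coord i).linear) y + b.coord i 0 := by
  ext y
  have := linear_coord_sub b i y 0
  rw [sub_zero] at this
  change _ = (b.coord i).linear y + _
  rw [this]
  ring

lemma contDiff_coord (i : Fin 3) : ContDiff ℝ ∞ (b.coord i) := by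
  rw [coe_coord_eq]
  exact (ContinuousLinearMap.contDiff _).add contDiff_const

lemma fderiv_coord_apply (i : Fin 3) (x d : Plane) :
    fderiv ℝ (b.coord i) x d = (b.coord i).linear d := by
  conv_lhs => rw [coe_coord_eq, fderiv_add_const, ContinuousLinearMap.fderiv]
  rfl

lemma sum_coord (x : Plane) : b.coord 0 x + b.coord 1 x + b.coord 2 x = 1 := by
  rw [← Fin.sum_univ_three fun i => b.coord i x]
  exact b.sum_coord_apply_eq_one x

lemma _root_.Fin.sum_eq_of_ne {i j l : Fin 3} (hij : i ≠ j) (hjl : j ≠ l) (hil : i ≠ l)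
    (f : Fin 3 → ℝ) : ∑ m, f m = f i + f j + f l := by
  fin_cases i <;> fin_cases j <;> fin_cases l <;> simp_all [Fin.sum_univ_three] <;> ring

lemma convex_ctCell (i : Fin 3) : Convex ℝ (b.ctCell i) := by
  have e : b.ctCell i = b.coord i ⁻¹' Set.Ici 0 ∩ ⋂ j, (b.coord j - b.coord i) ⁻¹' Set.Ici 0 := by
    ext x; simp [ctCell]
  rw [e]
  exact ((convex_Ici 0).affine_preimage _).inter
    (convex_iInter fun j => (convex_Ici 0).affine_preimage _)

lemma coord_centroid (i : Fin 3) :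
    b.coord i (Finset.univ.centroid ℝ b) = 1 / 3 := by
  rw [b.coord_apply_centroid (Finset.mem_univ i)]
  simp

lemma convexHull_update_centroid (i : Fin 3) :
    convexHull ℝ (Set.range (Function.update b i (Finset.univ.centroid ℝ b))) = b.ctCell i := by
  set z := Finset.univ.centroid ℝ b with hz
  have hzc := b.coord_centroid
  apply subset_antisymm
  · refine convexHull_min ?_ (b.convex_ctCell i)
    rintro _ ⟨m, rfl⟩
    by_cases hm : m = i
    · subst hm
      simp only [Function.update_self, ctCell, Set.mem_ofPred_eq, ← hz] at hzc ⊢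
      simp [hzc]
    · simp only [ctCell, Set.mem_ofPred_eq, Function.update_of_ne hm, b.coord_apply]
      rw [if_neg (Ne.symm hm)]
      refine ⟨le_rfl, fun j => ?_⟩
      split_ifs <;> norm_num
  · rintro x ⟨h0, h1⟩
    -- The centroid has all coordinates `1/3`, so weight `3 λ_i` on it supplies the whole `i`-th
    -- coordinate; the remainders `λ_m - λ_i` are nonnegative on the cell.
    have hx : x = ∑ m, (if m = i then 3 * b.coord i x else b.coord m x - b.coord i x)
        • Function.update b i z m := by
      have hz' := b.linear_combination_coord_eq_self z
      simp only [hz, hzc] at hz'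
      conv_lhs => rw [← b.linear_combination_coord_eq_self x]
      rw [← hz] at hz'
      simp only [Fin.sum_univ_three] at hz' ⊢
      rw [← hz']
      fin_cases i <;> simp <;> module
    rw [hx]
    refine (convex_convexHull ℝ _).sum_mem ?_ ?_ fun m _ => subset_convexHull _ _ ⟨m, rfl⟩
    · intro m _
      split_ifs
      · linarith
      · linarith [h1 m]
    · have := b.sum_coord x
      fin_cases i <;> simp [Fin.sum_univ_three] <;> linarith

lemma mem_interior_ctCell {i : Fin 3} {x : Plane} (h0 : 0 < b.coord i x)
    (h : ∀ j, j ≠ i → b.coord i x < b.coord j x) : x ∈ interior (b.ctCell i) := by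
  have hc : ∀ j, Continuous (b.coord j) := fun j => (b.contDiff_coord j).continuous
  refine mem_interior.2 ⟨{x | 0 < b.coord i x} ∩ ⋂ j, {x | j ≠ i → b.coord i x < b.coord j x},
    ?_, ?_, h0, by simpa using h⟩
  · rintro y ⟨hy0, hy⟩
    refine ⟨le_of_lt hy0, fun j => ?_⟩
    by_cases hj : j = i
    · rw [hj]
    · exact (Set.mem_iInter.1 hy j hj).le
  · refine (isOpen_lt continuous_const (hc i)).inter (isOpen_iInter_of_finite fun j => ?_)
    by_cases hj : j = i
    · simp [hj]
    · simpa [hj] using isOpen_lt (hc i) (hc j)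

lemma isClosed_ctCell (i : Fin 3) : IsClosed (b.ctCell i) := by
  have hc : ∀ j, Continuous (b.coord j) := fun j => (b.contDiff_coord j).continuous
  have e : b.ctCell i = {x | 0 ≤ b.coord i x} ∩ ⋂ j, {x | b.coord i x ≤ b.coord j x} := by
    ext x; simp [ctCell]
  rw [e]
  exact (isClosed_le continuous_const (hc i)).inter
    (isClosed_iInter fun j => isClosed_le (hc i) (hc j))

lemma iUnion_ctCell : ⋃ i, b.ctCell i = convexHull ℝ (Set.range b) := by
  rw [b.convexHull_eq_nonneg_coord]
  ext x
  simp only [ctCell, Set.mem_iUnion, Set.mem_ofPred_eq]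
  constructor
  · rintro ⟨i, h0, h⟩ j
    exact h0.trans (h j)
  · intro h
    obtain ⟨i, -, hi⟩ := Finset.exists_min_image Finset.univ (fun i => b.coord i x) ⟨0, by simp⟩
    exact ⟨i, h i, fun j => hi j (Finset.mem_univ j)⟩

/-- Up to a null set, a triangle is the union of the open cells of its split. -/
lemma ae_mem_interior_ctCell :
    ∀ᵐ x, x ∈ convexHull ℝ (Set.range b) → ∃ i, x ∈ interior (b.ctCell i) := by
  have h : ∀ i, ∀ᵐ x, x ∉ frontier (b.ctCell i) := fun i =>
    measure_eq_zero_iff_ae_notMem.1 ((b.convex_ctCell i).addHaar_frontier volume)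
  filter_upwards [ae_all_iff.2 h] with x hx hxT
  rw [← iUnion_ctCell] at hxT
  obtain ⟨i, hi⟩ := Set.mem_iUnion.1 hxT
  refine ⟨i, by_contra fun hn => hx i ?_⟩
  exact ⟨subset_closure hi, hn⟩

lemma exists_chart {e d : Plane} (h : ∀ s t : ℝ, s • e + t • d = 0 → s = 0 ∧ t = 0) :
    ∃ L : (ℝ × ℝ) ≃L[ℝ] Plane, ∀ y, L y = y.1 • e + y.2 • d := by
  let f : (ℝ × ℝ) →ₗ[ℝ] Plane :=
    (LinearMap.toSpanSingleton ℝ Plane e).coprod (LinearMap.toSpanSingleton ℝ Plane d)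
  have hf : Function.Injective f := by
    rw [injective_iff_map_eq_zero]
    rintro ⟨s, t⟩ hst
    obtain ⟨h1, h2⟩ := h s t (by simpa [f] using hst)
    rw [h1, h2]; rfl
  refine ⟨(f.linearEquivOfInjective hf (by simp)).toContinuousLinearEquiv, fun y => ?_⟩
  simp [f]

end AffineBasis

/-! ### Quadratics in barycentric coordinates and their gluing -/

namespace AffineBasis

variable (b : AffineBasis (Fin 3) ℝ Plane)

lemma coord_add_apply (m : Fin 3) (x e d : Plane) (s t : ℝ) :
    b.coord m (x + (s • e + t • d)) =
      b.coord m x + s * (b.coord m).linear e + t * (b.coord m).linear d := by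
  rw [← add_assoc, coord_add_smul_apply, coord_add_smul_apply]

/-- Quadratic forms in the barycentric coordinates, as functions on the plane. -/
noncomputable def quadForms : Submodule ℝ (Plane → ℝ) :=
  Submodule.span ℝ (Set.range fun m : Fin 3 × Fin 3 => fun x => b.coord m.1 x * b.coord m.2 x)

lemma mul_mem_quadForms {f g : Plane → ℝ} {v w : Fin 3 → ℝ}
    (hf : ∀ x, f x = ∑ m, v m * b.coord m x) (hg : ∀ x, g x = ∑ m, w m * b.coord m x) :
    (fun x => f x * g x) ∈ b.quadForms := by
  have e : (fun x => f x * g x) = ∑ m : Fin 3, ∑ n : Fin 3,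
      (v m * w n) • fun x => b.coord m x * b.coord n x := by
    ext x
    simp only [hf, hg, Finset.sum_mul_sum, Finset.sum_apply, Pi.smul_apply, smul_eq_mul]
    refine Finset.sum_congr rfl fun m _ => Finset.sum_congr rfl fun n _ => by ring
  rw [e]
  exact Submodule.sum_mem _ fun m _ => Submodule.sum_mem _ fun n _ =>
    Submodule.smul_mem _ _ (Submodule.subset_span ⟨(m, n), rfl⟩)

/-- Homogenization: both `1` and the Cartesian coordinates are linear forms in the barycentric
coordinates, so every monomial of degree at most 2 is a product of two such forms. -/
lemma eval_mem_quadForms {p : MvPolynomial (Fin 2) ℝ} (hp : p.totalDegree ≤ 2) :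
    (fun x : Plane => MvPolynomial.eval (fun i => x i) p) ∈ b.quadForms := by
  have one : ∀ x : Plane, (1 : ℝ) = ∑ m, (1 : ℝ) * b.coord m x := fun x => by
    simp only [one_mul]
    exact (b.sum_coord_apply_eq_one x).symm
  have crd : ∀ (c : Fin 2) (x : Plane), x c = ∑ m, b m c * b.coord m x := fun c x => by
    have := congrArg (fun y : Plane => y c) (b.linear_combination_coord_eq_self x)
    simp only [Fin.sum_univ_three, PiLp.add_apply, PiLp.smul_apply, smul_eq_mul] at this
    rw [Fin.sum_univ_three]
    linear_combination -this
  have e : (fun x : Plane => MvPolynomial.eval (fun i => x i) p)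
      = ∑ d ∈ p.support, p.coeff d • fun x : Plane => x 0 ^ d 0 * x 1 ^ d 1 := by
    ext x
    simp [MvPolynomial.eval_eq', Fin.prod_univ_two]
  rw [e]
  refine Submodule.sum_mem _ fun d hd => Submodule.smul_mem _ _ ?_
  have hdeg : d 0 + d 1 ≤ 2 := by
    have := (MvPolynomial.le_totalDegree hd).trans hp
    rwa [Finsupp.sum_fintype _ _ (fun _ => rfl), Fin.sum_univ_two] at this
  have cases : (d 0 = 0 ∧ d 1 = 0) ∨ (d 0 = 0 ∧ d 1 = 1) ∨ (d 0 = 0 ∧ d 1 = 2)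
      ∨ (d 0 = 1 ∧ d 1 = 0) ∨ (d 0 = 1 ∧ d 1 = 1) ∨ (d 0 = 2 ∧ d 1 = 0) := by omega
  rcases cases with ⟨h0, h1⟩ | ⟨h0, h1⟩ | ⟨h0, h1⟩ | ⟨h0, h1⟩ | ⟨h0, h1⟩ | ⟨h0, h1⟩ <;>
    simp only [h0, h1, pow_zero, pow_one, pow_two]
  · exact b.mul_mem_quadForms one one
  · exact b.mul_mem_quadForms one (crd 1)
  · simpa using b.mul_mem_quadForms (crd 1) (crd 1)
  · exact b.mul_mem_quadForms (crd 0) one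
  · exact b.mul_mem_quadForms (crd 0) (crd 1)
  · simpa using b.mul_mem_quadForms (crd 0) (crd 0)

lemma exists_of_mem_quadForms {f : Plane → ℝ} (hf : f ∈ b.quadForms) {i j l : Fin 3}
    (hij : i ≠ j) (hjl : j ≠ l) (hil : i ≠ l) :
    ∃ A B C D E F : ℝ, ∀ x, f x = A * b.coord i x ^ 2 + B * b.coord j x ^ 2 + C * b.coord l x ^ 2
      + D * (b.coord i x * b.coord j x) + E * (b.coord i x * b.coord l x)
      + F * (b.coord j x * b.coord l x) := by
  induction hf using Submodule.span_induction with
  | mem f hf =>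
    obtain ⟨⟨m, n⟩, rfl⟩ := hf
    have hcov : ∀ m : Fin 3, m = i ∨ m = j ∨ m = l := by
      revert i j l; decide
    rcases hcov m with rfl | rfl | rfl <;> rcases hcov n with rfl | rfl | rfl
    · exact ⟨1, 0, 0, 0, 0, 0, fun x => by ring⟩
    · exact ⟨0, 0, 0, 1, 0, 0, fun x => by ring⟩
    · exact ⟨0, 0, 0, 0, 1, 0, fun x => by ring⟩
    · exact ⟨0, 0, 0, 1, 0, 0, fun x => by ring⟩
    · exact ⟨0, 1, 0, 0, 0, 0, fun x => by ring⟩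
    · exact ⟨0, 0, 0, 0, 0, 1, fun x => by ring⟩
    · exact ⟨0, 0, 0, 0, 1, 0, fun x => by ring⟩
    · exact ⟨0, 0, 0, 0, 0, 1, fun x => by ring⟩
    · exact ⟨0, 0, 1, 0, 0, 0, fun x => by ring⟩
  | zero => exact ⟨0, 0, 0, 0, 0, 0, fun x => by simp⟩
  | add f g _ _ hf hg =>
    obtain ⟨A, B, C, D, E, F, h⟩ := hf
    obtain ⟨A', B', C', D', E', F', h'⟩ := hg
    exact ⟨A + A', B + B', C + C', D + D', E + E', F + F', fun x => by
      rw [Pi.add_apply, h, h']; ring⟩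
  | smul r f _ hf =>
    obtain ⟨A, B, C, D, E, F, h⟩ := hf
    exact ⟨r * A, r * B, r * C, r * D, r * E, r * F, fun x => by
      rw [Pi.smul_apply, h, smul_eq_mul]; ring⟩

/-- On the edge `λ_i = 0` only the terms in `λ_j²`, `λ_l²` and `λ_j λ_l` survive. Three zeros kill
their coefficients, and every remaining term contains `λ_i`. -/
lemma quad_factor {f : Plane → ℝ} (hf : f ∈ b.quadForms) {i j l : Fin 3}
    (hij : i ≠ j) (hjl : j ≠ l) (hil : i ≠ l)
    (h0 : ∀ s ∈ Set.Ioo (2 / 5 : ℝ) (1 / 2), f (b j + s • (b l - b j)) = 0) :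
    ∃ α : Fin 3 → ℝ, ∀ x, f x = b.coord i x * ∑ m, α m * b.coord m x := by
  obtain ⟨A, B, C, D, E, F, h⟩ := b.exists_of_mem_quadForms hf hij hjl hil
  have key : ∀ s ∈ Set.Ioo (2 / 5 : ℝ) (1 / 2),
      B * (1 - s) ^ 2 + C * s ^ 2 + F * ((1 - s) * s) = 0 := by
    intro s hs
    have := h0 s hs
    rw [h] at this
    simp only [coord_add_smul_apply, linear_coord_sub, coord_apply, if_pos, if_neg hij, if_neg hil,
      if_neg hjl, if_neg hjl.symm] at this
    linear_combination this
  have k1 := key (21 / 50) (by constructor <;> norm_num)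
  have k2 := key (22 / 50) (by constructor <;> norm_num)
  have k3 := key (23 / 50) (by constructor <;> norm_num)
  have hB : B = 0 := by linarith
  have hC : C = 0 := by linarith
  have hF : F = 0 := by linarith
  refine ⟨fun m => if m = i then A else if m = j then D else E, fun x => ?_⟩
  rw [h, Fin.sum_eq_of_ne hij hjl hil, hB, hC, hF]
  simp only [if_pos, if_neg hij.symm, if_neg hil.symm, if_neg hjl.symm]
  ring

/-- On the median from `b j` one has `λ_i = λ_l = s ≠ 0` and `λ_j = 1 - 2 s`. The common factor `s`
cancels, and two values of `s` determine what remains, which is affine in `s`. -/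
lemma interface_match {f g : Plane → ℝ} {α γ : Fin 3 → ℝ} {i j l : Fin 3}
    (hij : i ≠ j) (hjl : j ≠ l) (hil : i ≠ l)
    (hf : ∀ x, f x = b.coord i x * ∑ m, α m * b.coord m x)
    (hg : ∀ x, g x = b.coord l x * ∑ m, γ m * b.coord m x)
    (h : ∀ s ∈ Set.Ioo (1 / 5 : ℝ) (1 / 4), f (b j + s • (b i + b l - (2 : ℝ) • b j))
      = g (b j + s • (b i + b l - (2 : ℝ) • b j))) :
    α j = γ j ∧ α i + α l = γ i + γ l := by
  have e : b i + b l - (2 : ℝ) • b j = (b i - b j) + (b l - b j) := by module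
  have key : ∀ s ∈ Set.Ioo (1 / 5 : ℝ) (1 / 4),
      α i * s + α j * (1 - 2 * s) + α l * s = γ i * s + γ j * (1 - 2 * s) + γ l * s := by
    intro s hs
    have := h s hs
    rw [hf, hg, Fin.sum_eq_of_ne hij hjl hil, Fin.sum_eq_of_ne hij hjl hil, e] at this
    simp only [coord_add_smul_apply, map_add, linear_coord_sub, coord_apply, if_pos, if_neg hij,
      if_neg hil, if_neg hij.symm, if_neg hil.symm, if_neg hjl, if_neg hjl.symm] at this
    have hs0 : s ≠ 0 := (lt_trans (by norm_num) hs.1).ne'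
    refine mul_left_cancel₀ hs0 ?_
    linear_combination this
  have k1 := key (21 / 100) (by constructor <;> norm_num)
  have k2 := key (22 / 100) (by constructor <;> norm_num)
  constructor <;> linarith

/-- Quadratic pieces on the Clough-Tocher split that vanish on the boundary and match across the
interior edges have a common factored form. -/
lemma exists_ct_form {f : Fin 3 → Plane → ℝ} (hf : ∀ i, f i ∈ b.quadForms)
    (hout : ∀ i j l : Fin 3, i ≠ j → j ≠ l → i ≠ l →
      ∀ s ∈ Set.Ioo (2 / 5 : ℝ) (1 / 2), f i (b j + s • (b l - b j)) = 0)
    (hin : ∀ i j l : Fin 3, i ≠ j → j ≠ l → i ≠ l → ∀ s ∈ Set.Ioo (1 / 5 : ℝ) (1 / 4),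
      f i (b j + s • (b i + b l - (2 : ℝ) • b j)) = f l (b j + s • (b i + b l - (2 : ℝ) • b j))) :
    ∃ (β : Fin 3 → ℝ) (a : ℝ), ∀ i x,
      f i x = b.coord i x * (∑ m, β m * b.coord m x + a * b.coord i x) := by
  have hex : ∀ i, ∃ α : Fin 3 → ℝ, ∀ x, f i x = b.coord i x * ∑ m, α m * b.coord m x := by
    intro i
    have h : ∀ i : Fin 3, i ≠ i + 1 ∧ i + 1 ≠ i + 2 ∧ i ≠ i + 2 := by decide
    exact b.quad_factor (hf i) (h i).1 (h i).2.1 (h i).2.2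
      (hout i _ _ (h i).1 (h i).2.1 (h i).2.2)
  choose α hα using hex
  have m := fun i j l (hij : i ≠ j) (hjl : j ≠ l) (hil : i ≠ l) =>
    b.interface_match hij hjl hil (hα i) (hα l) (hin i j l hij hjl hil)
  obtain ⟨h1, h2⟩ := m 0 2 1 (by decide) (by decide) (by decide)
  obtain ⟨h3, h4⟩ := m 0 1 2 (by decide) (by decide) (by decide)
  obtain ⟨h5, h6⟩ := m 1 0 2 (by decide) (by decide) (by decide)
  -- The first matching relation says that the coefficient of `λ_m` is the same in both cells other
  -- than `m`; this is `β m`. The second says that `α i i - β i` does not depend on `i`; this is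
  -- `a`.
  refine ⟨![α 1 0, α 0 1, α 0 2], α 0 0 - α 1 0, fun i x => ?_⟩
  rw [hα i]
  congr 1
  fin_cases i
  · simp [Fin.sum_univ_three]; ring
  · simp [Fin.sum_univ_three]
    linear_combination (-b.coord 2 x) * h1 - b.coord 1 x * h2
  · simp [Fin.sum_univ_three]
    linear_combination (-b.coord 1 x) * h3 - b.coord 2 x * h4 - b.coord 0 x * h5
      + b.coord 2 x * h5

end AffineBasis

/-! ### Traces on the edges of the split -/

namespace AffineBasis

variable (b : AffineBasis (Fin 3) ℝ Plane)

lemma contDiff_of_mem_quadForms {f : Plane → ℝ} (hf : f ∈ b.quadForms) : ContDiff ℝ ∞ f := by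
  induction hf using Submodule.span_induction with
  | mem f hf =>
    obtain ⟨⟨m, n⟩, rfl⟩ := hf
    exact (b.contDiff_coord m).mul (b.contDiff_coord n)
  | zero => exact contDiff_const
  | add f g _ _ hf hg => exact hf.add hg
  | smul r f _ hf => exact contDiff_const.smul hf

lemma interior_ctCell_subset (i : Fin 3) :
    interior (b.ctCell i) ⊆ interior (convexHull ℝ (Set.range b)) := by
  refine interior_mono ?_
  rw [← b.iUnion_ctCell]
  exact Set.subset_iUnion _ i

section Traces

variable {b} {u : Plane → ℝ} {f : Fin 3 → Plane → ℝ} {g : Fin 2 → Plane → ℝ}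
  (hf : ∀ i, ContDiff ℝ ∞ (f i))
  (hu : ∀ i, ∀ᵐ x, x ∈ interior (b.ctCell i) → u x = f i x)
  (hg : ∀ j, IsWeakPartial (interior (convexHull ℝ (Set.range b))) j u (g j))
  (hw : ∀ (d : Plane) (φ : Plane → ℝ), ContDiff ℝ ∞ φ → HasCompactSupport φ →
    ∫ x, ((interior (convexHull ℝ (Set.range b))).indicator u x * fderiv ℝ φ x d
      + (interior (convexHull ℝ (Set.range b))).indicator (fun x => ∑ j, d j * g j x) x * φ x) = 0)

include hf hu hg in
lemma ae_weak_data_cell (i : Fin 3) (d : Plane) : ∀ᵐ x, x ∈ interior (b.ctCell i) →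
    (interior (convexHull ℝ (Set.range b))).indicator u x = f i x ∧
    (interior (convexHull ℝ (Set.range b))).indicator (fun x => ∑ j, d j * g j x) x
      = fderiv ℝ (f i) x d := by
  have h := fun j => (hg j).ae_eq_partialD isOpen_interior (b.interior_ctCell_subset i) (hf i) (hu i)
  filter_upwards [hu i, ae_all_iff.2 h] with x h1 h2 hx
  have hxD := b.interior_ctCell_subset i hx
  rw [Set.indicator_of_mem hxD, Set.indicator_of_mem hxD, fderiv_apply_eq_sum_partialD]
  exact ⟨h1 hx, Finset.sum_congr rfl fun j _ => by rw [h2 j hx]⟩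

-- In the chart `λ_i = t`, `λ_l = s`, `λ_j = 1 - s - t`. For small `t > 0` the point lies in the
-- cell `i`; for `t < 0` it lies outside the triangle, where the zero extension vanishes.
include hf hu hg hw in
lemma outer_trace {i j l : Fin 3} (hij : i ≠ j) (hjl : j ≠ l) (hil : i ≠ l) :
    ∀ s ∈ Set.Ioo (2 / 5 : ℝ) (1 / 2), f i (b j + s • (b l - b j)) = 0 := by
  have hcov : ∀ m : Fin 3, m = i ∨ m = j ∨ m = l := by
    revert i j l; decide
  have hn : ∀ m, (b.coord m).linear (b l - b j) = (if m = l then 1 else 0) - if m = j then 1 else 0 :=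
    fun m => by rw [linear_coord_sub, coord_apply, coord_apply]
  have hn' : ∀ m, (b.coord m).linear (b i - b j)
      = (if m = i then 1 else 0) - if m = j then 1 else 0 :=
    fun m => by rw [linear_coord_sub, coord_apply, coord_apply]
  obtain ⟨L, hL⟩ := exists_chart (e := b l - b j) (d := b i - b j) (by
    intro s t h
    have h1 := congrArg (b.coord l).linear h
    have h2 := congrArg (b.coord i).linear h
    simp only [map_add, map_smul, hn, hn', map_zero, if_pos, if_neg hij, if_neg hil,
      if_neg hil.symm, if_neg hjl.symm, smul_eq_mul] at h1 h2
    constructor <;> linarith)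
  have hcoord : ∀ m s t, b.coord m (b j + L (s, t)) = (if m = j then 1 else 0)
      + s * ((if m = l then 1 else 0) - if m = j then 1 else 0)
      + t * ((if m = i then 1 else 0) - if m = j then 1 else 0) := by
    intro m s t
    rw [hL, coord_add_apply, hn, hn', coord_apply]
  have := trace_eq (x₀ := b j) (L := L) (q := fun _ => 0) (hw (L (0, 1)))
    ((hf i).of_le (by simp)) contDiff_const (ae_weak_data_cell hf hu hg i (L (0, 1)))
    (B := {x | b.coord i x < 0}) (a := 2 / 5) (b := 1 / 2) (r := 1 / 10)
    (Eventually.of_forall ?_) (by norm_num) ?_ ?_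
  · intro s hs
    simpa [hL] using this s hs
  · intro x hx
    have hxD : x ∉ interior (convexHull ℝ (Set.range b)) := by
      rw [b.interior_convexHull]
      exact fun h => absurd (h i) (not_lt.2 (le_of_lt hx))
    simp [Set.indicator_of_notMem hxD]
  · rintro s t ⟨hs1, hs2⟩ ⟨ht1, ht2⟩
    refine b.mem_interior_ctCell ?_ fun m hm => ?_
    · rw [hcoord]
      simp only [if_pos, if_neg hij, if_neg hil]
      linarith
    · rw [hcoord, hcoord]
      rcases hcov m with rfl | rfl | rfl
      · exact absurd rfl hm
      · simp only [if_pos, if_neg hij, if_neg hij.symm, if_neg hil, if_neg hjl]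
        linarith
      · simp only [if_pos, if_neg hij, if_neg hil.symm, if_neg hil, if_neg hjl.symm]
        linarith
  · rintro s t ⟨hs1, hs2⟩ ⟨ht1, ht2⟩
    rw [Set.mem_ofPred_eq, hcoord]
    simp only [if_pos, if_neg hij, if_neg hil]
    linarith

-- In the chart `λ_i = s - t`, `λ_l = s + t`, `λ_j = 1 - 2 s`, so the line `t = 0` is the median
-- from `b j`. The chosen ranges keep `λ_j` the largest and all coordinates positive; the sign of
-- `t` decides between the cells `i` and `l`.
include hf hu hg hw in
lemma inner_trace {i j l : Fin 3} (hij : i ≠ j) (hjl : j ≠ l) (hil : i ≠ l) :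
    ∀ s ∈ Set.Ioo (1 / 5 : ℝ) (1 / 4), f i (b j + s • (b i + b l - (2 : ℝ) • b j))
      = f l (b j + s • (b i + b l - (2 : ℝ) • b j)) := by
  have hcov : ∀ m : Fin 3, m = i ∨ m = j ∨ m = l := by
    revert i j l; decide
  have he : b i + b l - (2 : ℝ) • b j = (b i - b j) + (b l - b j) := by module
  have hn : ∀ m, (b.coord m).linear (b i + b l - (2 : ℝ) • b j)
      = (if m = i then 1 else 0) + (if m = l then 1 else 0) - 2 * if m = j then 1 else 0 :=
    fun m => by
      rw [he, map_add, linear_coord_sub, linear_coord_sub, coord_apply, coord_apply, coord_apply]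
      ring
  have hn' : ∀ m, (b.coord m).linear (b l - b i)
      = (if m = l then 1 else 0) - if m = i then 1 else 0 :=
    fun m => by rw [linear_coord_sub, coord_apply, coord_apply]
  obtain ⟨L, hL⟩ := exists_chart (e := b i + b l - (2 : ℝ) • b j) (d := b l - b i) (by
    intro s t h
    have h1 := congrArg (b.coord l).linear h
    have h2 := congrArg (b.coord i).linear h
    simp only [map_add, map_smul, hn, hn', map_zero, if_pos, if_neg hij, if_neg hil,
      if_neg hil.symm, if_neg hjl.symm, smul_eq_mul] at h1 h2
    constructor <;> linarith)
  have hcoord : ∀ m s t, b.coord m (b j + L (s, t)) = (if m = j then 1 else 0)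
      + s * ((if m = i then 1 else 0) + (if m = l then 1 else 0) - 2 * if m = j then 1 else 0)
      + t * ((if m = l then 1 else 0) - if m = i then 1 else 0) := by
    intro m s t
    rw [hL, coord_add_apply, hn, hn', coord_apply]
  have := trace_eq (x₀ := b j) (L := L) (hw (L (0, 1)))
    ((hf i).of_le (by simp)) ((hf l).of_le (by simp)) (ae_weak_data_cell hf hu hg i (L (0, 1)))
    (ae_weak_data_cell hf hu hg l (L (0, 1))) (a := 1 / 5) (b := 1 / 4) (r := 1 / 10)
    (by norm_num) ?_ ?_
  · intro s hs
    simpa [hL] using this s hs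
  · rintro s t ⟨hs1, hs2⟩ ⟨ht1, ht2⟩
    refine b.mem_interior_ctCell ?_ fun m hm => ?_
    · rw [hcoord]
      simp only [if_pos, if_neg hij, if_neg hil]
      linarith
    · rw [hcoord, hcoord]
      rcases hcov m with rfl | rfl | rfl
      · exact absurd rfl hm
      · simp only [if_pos, if_neg hij, if_neg hij.symm, if_neg hil, if_neg hjl]
        linarith
      · simp only [if_pos, if_neg hij, if_neg hil.symm, if_neg hil, if_neg hjl.symm]
        linarith
  · rintro s t ⟨hs1, hs2⟩ ⟨ht1, ht2⟩
    refine b.mem_interior_ctCell ?_ fun m hm => ?_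
    · rw [hcoord]
      simp only [if_pos, if_neg hjl.symm, if_neg hil.symm]
      linarith
    · rw [hcoord, hcoord]
      rcases hcov m with rfl | rfl | rfl
      · simp only [if_pos, if_neg hij, if_neg hil.symm, if_neg hil, if_neg hjl.symm]
        linarith
      · simp only [if_pos, if_neg hjl.symm, if_neg hij.symm, if_neg hil.symm, if_neg hjl]
        linarith
      · exact absurd rfl hm

end Traces

end AffineBasis

/-! ### Normal form of the finite element functions -/

namespace Affine.Simplex

lemma cloughTocher_centroid (T : Affine.Triangle ℝ Plane) :
    cloughTocher T T.centroid = Set.range T.planeBasis.ctCell :=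
  congrArg Set.range (funext fun i => T.planeBasis.convexHull_update_centroid i)

lemma closedInterior_eq_convexHull_planeBasis (T : Affine.Triangle ℝ Plane) :
    T.closedInterior = convexHull ℝ (Set.range T.planeBasis) :=
  T.convexHull_eq_closedInterior.symm

lemma meshDomain_cloughTocher (T : Affine.Triangle ℝ Plane) :
    meshDomain (cloughTocher T T.centroid) = interior (convexHull ℝ (Set.range T.planeBasis)) := by
  rw [meshDomain, T.cloughTocher_centroid, Set.biUnion_range, ← T.planeBasis.iUnion_ctCell]
  simp_rw [(T.planeBasis.isClosed_ctCell _).closure_eq]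

/-- The form of a continuous piecewise quadratic function with zero boundary values on the
Clough-Tocher split. -/
theorem exists_ct_form_of_memH10 (T : Affine.Triangle ℝ Plane) {u : Plane → ℝ}
    (hp : IsPiecewisePoly 2 (cloughTocher T T.centroid) u)
    (hu : MemH10 (meshDomain (cloughTocher T T.centroid)) u) :
    ∃ (β : Fin 3 → ℝ) (a : ℝ), ∀ i, ∀ᵐ x, x ∈ interior (T.planeBasis.ctCell i) →
      u x = T.planeBasis.coord i x
        * (∑ m, β m * T.planeBasis.coord m x + a * T.planeBasis.coord i x) := by
  set b := T.planeBasis with hb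
  have hex : ∀ i, ∃ f ∈ b.quadForms, ∀ᵐ x, x ∈ interior (b.ctCell i) → u x = f x := by
    intro i
    obtain ⟨p, hdeg, hup⟩ := hp.2 (b.ctCell i) (by rw [T.cloughTocher_centroid]; exact ⟨i, rfl⟩)
    refine ⟨_, b.eval_mem_quadForms hdeg, ?_⟩
    rw [ae_restrict_iff' (b.isClosed_ctCell i).measurableSet] at hup
    filter_upwards [hup] with x hx hxi
    exact hx (interior_subset hxi)
  choose f hf hfu using hex
  rw [T.meshDomain_cloughTocher] at hu
  obtain ⟨g, hg, hw⟩ := hu.exists_weak_directional isOpen_interior.measurableSet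
  have hfs := fun i => b.contDiff_of_mem_quadForms (hf i)
  obtain ⟨β, a, h⟩ := b.exists_ct_form hf
    (fun i j l hij hjl hil => AffineBasis.outer_trace hfs hfu hg hw hij hjl hil)
    (fun i j l hij hjl hil => AffineBasis.inner_trace hfs hfu hg hw hij hjl hil)
  refine ⟨β, a, fun i => ?_⟩
  filter_upwards [hfu i] with x hx hxi
  rw [hx hxi, h]

end Affine.Simplex

/-! ### Edges, heights, aspect ratio and angles -/

namespace Affine.Simplex

lemma height_le_dist (T : Affine.Triangle ℝ Plane) {i j : Fin 3} (h : i ≠ j) :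
    T.height i ≤ dist (T.points i) (T.points j) := by
  have h1 := T.inner_vsub_vsub_altitudeFoot_eq_height_sq h
  have h2 := real_inner_le_norm (T.points i -ᵥ T.points j) (T.points i -ᵥ T.altitudeFoot i)
  rw [h1, ← dist_eq_norm_vsub, ← dist_eq_norm_vsub] at h2
  have h3 := T.height_pos i
  change T.height i ^ 2 ≤ _ * T.height i at h2
  nlinarith

/-- The inverse inradius is the sum of the inverse heights, and each inverse height is less than the
sum of the other two. -/
lemma two_mul_inradius_le_height (T : Affine.Triangle ℝ Plane) (i : Fin 3) :
    2 * T.inradius ≤ T.height i := by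
  have h1 := T.inv_height_lt_sum_inv_height i
  have hp := fun j => inv_pos.2 (T.height_pos j)
  have hs : 2 * (T.height i)⁻¹ ≤ ∑ j, (T.height j)⁻¹ := by
    rw [← Finset.add_sum_erase _ _ (Finset.mem_univ i), ← Finset.filter_ne']
    linarith
  have hr : T.inradius = (∑ j, (T.height j)⁻¹)⁻¹ := by
    rw [inradius_eq_abs_inv_sum, abs_of_nonneg]
    · simp [excenterWeightsUnnorm]
    · simp only [excenterWeightsUnnorm, Finset.notMem_empty, if_false, one_mul]
      exact inv_nonneg.2 (Finset.sum_nonneg fun j _ => (hp j).le)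
  have hi := hp i
  rw [hr, ← div_eq_mul_inv, div_le_iff₀ (lt_of_lt_of_le (by positivity) hs)]
  calc (2 : ℝ) = T.height i * (2 * (T.height i)⁻¹) := by
        field_simp [(T.height_pos i).ne']
    _ ≤ _ := mul_le_mul_of_nonneg_left hs (T.height_pos i).le

lemma dist_le_longestEdge (T : Affine.Triangle ℝ Plane) (i j : Fin 3) :
    dist (T.points i) (T.points j) ≤ longestEdge T := by
  unfold longestEdge
  have h0 : (0 : ℝ) ≤ dist (T.points 0) (T.points 1) := dist_nonneg
  fin_cases i <;> fin_cases j <;> simp [h0, dist_comm (T.points 1) (T.points 0),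
    dist_comm (T.points 2) (T.points 1), dist_comm (T.points 0) (T.points 2)]

/-- The aspect ratio bounds the quotient of any two edge lengths. -/
lemma dist_le_aspectRatio_mul_dist (T : Affine.Triangle ℝ Plane) {i j m n : Fin 3}
    (hmn : m ≠ n) :
    dist (T.points i) (T.points j) ≤ aspectRatio T * dist (T.points m) (T.points n) := by
  have hr := T.inradius_pos
  have h1 := (T.two_mul_inradius_le_height m).trans (T.height_le_dist hmn)
  have h2 := T.dist_le_longestEdge i j
  rw [aspectRatio, div_mul_eq_mul_div, le_div_iff₀ (by positivity)]
  exact mul_le_mul h2 h1 (by positivity) (dist_nonneg.trans h2)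

lemma aspectRatio_pos (T : Affine.Triangle ℝ Plane) : 0 < aspectRatio T := by
  have h := T.dist_le_aspectRatio_mul_dist (i := 0) (j := 1) (m := 0) (n := 1) (by decide)
  have h0 : 0 < dist (T.points 0) (T.points 1) :=
    dist_pos.2 (T.independent.injective.ne (by decide))
  by_contra hn
  nlinarith

/-- Under the large angle condition some angle has sine bounded below. -/
lemma exists_sin_angle_ge (T : Affine.Triangle ℝ Plane) {δ : ℝ} (hδ : 0 < δ)
    (hT : LargeAngleCond δ T) : ∃ k : Fin 3, Real.sin (min δ (Real.pi / 3)) ≤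
      Real.sin (EuclideanGeometry.angle (T.points (k + 1)) (T.points k) (T.points (k + 2))) := by
  have hpi := Real.pi_pos
  have hsum := EuclideanGeometry.angle_add_angle_add_angle_eq_pi (p₁ := T.points 0)
    (p₂ := T.points 1) (T.points 2) (T.independent.injective.ne (by decide))
  have hk : ∃ k : Fin 3, Real.pi / 3 ≤
      EuclideanGeometry.angle (T.points (k + 1)) (T.points k) (T.points (k + 2)) := by
    by_contra! h
    have h0 := h 0
    have h1 := h 1
    have h2 := h 2
    simp only [Fin.isValue, zero_add, Fin.reduceAdd] at h0 h1 h2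
    rw [EuclideanGeometry.angle_comm (T.points 2) (T.points 1) (T.points 0)] at h1
    rw [EuclideanGeometry.angle_comm (T.points 0) (T.points 2) (T.points 1)] at h2
    rw [EuclideanGeometry.angle_comm (T.points 1) (T.points 0) (T.points 2)] at h0
    linarith
  obtain ⟨k, hk⟩ := hk
  refine ⟨k, ?_⟩
  have hlt := hT k
  set θ := EuclideanGeometry.angle (T.points (k + 1)) (T.points k) (T.points (k + 2))
  have hm : 0 < min δ (Real.pi / 3) := lt_min hδ (by positivity)
  have hm1 : min δ (Real.pi / 3) ≤ δ := min_le_left _ _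
  have hm2 : min δ (Real.pi / 3) ≤ Real.pi / 3 := min_le_right _ _
  -- Here `π / 3 ≤ θ < π - δ`. An acute `θ` is compared with `π / 3`, an obtuse one through `π - θ >
  -- δ`.
  rcases le_total θ (Real.pi / 2) with h | h
  · exact Real.sin_le_sin_of_le_of_le_pi_div_two (by linarith) h (by linarith)
  · rw [← Real.sin_pi_sub θ]
    exact Real.sin_le_sin_of_le_of_le_pi_div_two (by linarith) (by linarith) (by linarith)

end Affine.Simplex

/-! ### Linear algebra and a quadrature estimate -/

lemma sin_angle_mul_norm_eq_abs_det (e d : Plane) :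
    Real.sin (InnerProductGeometry.angle e d) * (‖e‖ * ‖d‖) = |e 0 * d 1 - e 1 * d 0| := by
  rw [InnerProductGeometry.sin_angle_mul_norm_mul_norm, ← Real.sqrt_sq_eq_abs]
  congr 1
  simp only [PiLp.inner_apply, Fin.sum_univ_two, RCLike.inner_apply, conj_trivial]
  ring

lemma abs_apply_le_norm (e : Plane) (c : Fin 2) : |e c| ≤ ‖e‖ := by
  simpa using PiLp.norm_apply_le e c

/-- The entries of a dual basis vector, by Cramer's rule. -/
lemma abs_dual_mul_det_le {e d : Plane} {n : Fin 2 → ℝ} (h1 : ∑ c, n c * e c = 1)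
    (h2 : ∑ c, n c * d c = 0) (l : Fin 2) : |n l| * |e 0 * d 1 - e 1 * d 0| ≤ ‖d‖ := by
  rw [Fin.sum_univ_two] at h1 h2
  rw [← abs_mul]
  fin_cases l
  · have : n 0 * (e 0 * d 1 - e 1 * d 0) = d 1 := by linear_combination d 1 * h1 - e 1 * h2
    simpa [this] using abs_apply_le_norm d 1
  · have : n 1 * (e 0 * d 1 - e 1 * d 0) = -d 0 := by linear_combination -d 0 * h1 + e 0 * h2
    simpa [this] using abs_apply_le_norm d 0

/-- A matrix with vanishing row sums and a vector are controlled by the coefficients of the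
piecewise divergence. -/
lemma coeff_le_of_div_coeff_le {C : Fin 3 → Fin 3 → ℝ} {A : Fin 3 → ℝ} {δ : ℝ}
    (hC : ∀ m, ∑ q, C m q = 0)
    (hd : ∀ i m, |C m i + if m = i then 2 * A i + ∑ p, C p p else 0| ≤ δ) :
    (∀ m q, |C m q| ≤ 2 * δ) ∧ ∀ q, |A q| ≤ 5 * δ := by
  have hδ : 0 ≤ δ := (abs_nonneg _).trans (hd 0 0)
  have r0 := hC 0
  have r1 := hC 1
  have r2 := hC 2
  have d00 := abs_le.1 (hd 0 0)
  have d01 := abs_le.1 (hd 0 1)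
  have d02 := abs_le.1 (hd 0 2)
  have d10 := abs_le.1 (hd 1 0)
  have d11 := abs_le.1 (hd 1 1)
  have d12 := abs_le.1 (hd 1 2)
  have d20 := abs_le.1 (hd 2 0)
  have d21 := abs_le.1 (hd 2 1)
  have d22 := abs_le.1 (hd 2 2)
  -- For `m ≠ i` the data bound `C m i` by `δ`, so zero row sums bound `C m m` by `2 δ`. The
  -- diagonal data then give `2 |A i| ≤ δ + 2 δ + 6 δ`.
  simp [Fin.sum_univ_three] at r0 r1 r2 d00 d01 d02 d10 d11 d12 d20 d21 d22
  constructor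
  · intro m q
    rw [abs_le]
    fin_cases m <;> fin_cases q <;> simp <;> constructor <;> linarith
  · intro q
    rw [abs_le]
    fin_cases q <;> simp <;> constructor <;> linarith

lemma integral_quadratic (p q r : ℝ) :
    ∫ t in (2 / 5 : ℝ)..(1 / 2), (p + q * t + r * t ^ 2) = p / 10 + q * (9 / 200) + r * (61 / 3000) := by
  rw [intervalIntegral.integral_add (by apply Continuous.intervalIntegrable; fun_prop)
      (by apply Continuous.intervalIntegrable; fun_prop),
    intervalIntegral.integral_add (by apply Continuous.intervalIntegrable; fun_prop)
      (by apply Continuous.intervalIntegrable; fun_prop)]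
  have h : ∫ t in (2 / 5 : ℝ)..(1 / 2), q * t = q * ∫ t in (2 / 5 : ℝ)..(1 / 2), t :=
    intervalIntegral.integral_const_mul _ _
  rw [h, integral_id]
  simp only [intervalIntegral.integral_const, intervalIntegral.integral_const_mul,
    integral_pow, smul_eq_mul]
  norm_num
  ring

lemma setIntegral_Ioo_quadratic (p q r : ℝ) :
    ∫ t in Set.Ioo (2 / 5 : ℝ) (1 / 2), (p + q * t + r * t ^ 2)
      = p / 10 + q * (9 / 200) + r * (61 / 3000) := by
  rw [← integral_Ioc_eq_integral_Ioo, ← intervalIntegral.integral_of_le (by norm_num),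
    integral_quadratic]

/-- A quantitative form of the positive definiteness of the Gram matrix of `1 - s - t`, `s`, `t` on
a small box. The box is chosen so that its image lies inside one cell of the split. -/
lemma sq_coeff_le_integral_box (x y z : ℝ) :
    x ^ 2 + y ^ 2 + z ^ 2 ≤ 1000000 *
      ∫ w in Set.Ioo (2 / 5 : ℝ) (1 / 2) ×ˢ Set.Ioo (2 / 5 : ℝ) (1 / 2),
        (x * (1 - w.1 - w.2) + y * w.1 + z * w.2) ^ 2 := by
  have hint : IntegrableOn (fun w : ℝ × ℝ => (x * (1 - w.1 - w.2) + y * w.1 + z * w.2) ^ 2)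
      (Set.Ioo (2 / 5 : ℝ) (1 / 2) ×ˢ Set.Ioo (2 / 5 : ℝ) (1 / 2)) := by
    have hc : Continuous fun w : ℝ × ℝ => (x * (1 - w.1 - w.2) + y * w.1 + z * w.2) ^ 2 := by
      fun_prop
    exact (hc.continuousOn.integrableOn_compact (isCompact_Icc.prod isCompact_Icc)).mono_set
      (Set.prod_mono Set.Ioo_subset_Icc_self Set.Ioo_subset_Icc_self)
  rw [Measure.volume_eq_prod] at hint ⊢
  rw [setIntegral_prod _ hint]
  have e1 : ∀ s t : ℝ, (x * (1 - s - t) + y * s + z * t) ^ 2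
      = (x + (y - x) * s) ^ 2 + 2 * (x + (y - x) * s) * (z - x) * t + (z - x) ^ 2 * t ^ 2 :=
    fun s t => by ring
  simp_rw [e1, setIntegral_Ioo_quadratic]
  have e2 : ∀ s : ℝ, (x + (y - x) * s) ^ 2 / 10 + 2 * (x + (y - x) * s) * (z - x) * (9 / 200)
      + (z - x) ^ 2 * (61 / 3000)
      = (x ^ 2 / 10 + 2 * x * (z - x) * (9 / 200) + (z - x) ^ 2 * (61 / 3000))
        + (2 * x * (y - x) / 10 + 2 * (y - x) * (z - x) * (9 / 200)) * s
        + (y - x) ^ 2 / 10 * s ^ 2 := fun s => by ring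
  simp_rw [e2, setIntegral_Ioo_quadratic]
  -- With `M` the value at the centre `(9/20, 9/20)`, the integral is `(M² + ((y - x)² + (z - x)²) /
  -- 1200) / 100`, since each variable has variance `1/1200`.
  nlinarith [sq_nonneg (x + (9 / 20) * (y - x) + 9 / 20 * (z - x)), sq_nonneg (y - x),
    sq_nonneg (z - x), sq_nonneg (2 * (x + (9 / 20) * (y - x) + 9 / 20 * (z - x)) + (y - x)),
    sq_nonneg (2 * (x + (9 / 20) * (y - x) + 9 / 20 * (z - x)) + (z - x)), sq_nonneg (y - z)]

/-! ### Gradients of barycentric coordinates and coefficient bounds -/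

namespace AffineBasis

variable (b : AffineBasis (Fin 3) ℝ Plane)

/-- The `c`-th component of the gradient of the `q`-th barycentric coordinate. -/
noncomputable def grad (q : Fin 3) (c : Fin 2) : ℝ :=
  (b.coord q).linear (EuclideanSpace.single c 1)

lemma linear_coord_apply (q : Fin 3) (w : Plane) :
    (b.coord q).linear w = ∑ c, w c * b.grad q c := by
  have hw : w = ∑ c, w c • EuclideanSpace.single c (1 : ℝ) := by
    ext i
    fin_cases i <;> simp [Fin.sum_univ_two]
  conv_lhs => rw [hw, map_sum]
  simp only [map_smul, smul_eq_mul, grad]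

lemma sum_linear_coord (w : Plane) : ∑ q, (b.coord q).linear w = 0 := by
  have h := fun q => b.linear_coord_sub q w 0
  simp only [sub_zero] at h
  rw [Finset.sum_congr rfl fun q _ => h q, Finset.sum_sub_distrib, b.sum_coord_apply_eq_one,
    b.sum_coord_apply_eq_one, sub_self]

lemma ne_shift (k : Fin 3) : k ≠ k + 1 ∧ k + 1 ≠ k + 2 ∧ k ≠ k + 2 := by
  revert k; decide

lemma eq_shift (k q : Fin 3) : q = k ∨ q = k + 1 ∨ q = k + 2 := by
  revert q k; decide

lemma eq_edge_combination (k : Fin 3) (w : Plane) :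
    w = (b.coord (k + 1)).linear w • (b (k + 1) - b k)
      + (b.coord (k + 2)).linear w • (b (k + 2) - b k) := by
  obtain ⟨h1, h2, h3⟩ := ne_shift k
  have hs := b.sum_linear_coord w
  rw [Fin.sum_eq_of_ne h1 h2 h3] at hs
  have key : b k + (1 : ℝ) • w = b k + ((b.coord (k + 1)).linear w • (b (k + 1) - b k)
      + (b.coord (k + 2)).linear w • (b (k + 2) - b k)) := by
    refine b.ext_elem fun q => ?_
    rw [coord_add_smul_apply, coord_add_apply, linear_coord_sub, linear_coord_sub]
    rcases eq_shift k q with rfl | rfl | rfl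
    · simp only [coord_apply, if_pos, if_neg h1, if_neg h3]
      linarith
    · simp only [coord_apply, if_pos, if_neg h1.symm, if_neg h2]
      linarith
    · simp only [coord_apply, if_pos, if_neg h2.symm, if_neg h3.symm]
      linarith
  rw [one_smul] at key
  exact add_left_cancel key

lemma partialD_ct_form (β : Fin 3 → ℝ) (a : ℝ) (i : Fin 3) (l : Fin 2) (x : Plane) :
    partialD l (fun x => b.coord i x * (∑ m, β m * b.coord m x + a * b.coord i x)) x
      = (∑ m, β m * b.coord m x + a * b.coord i x) * b.grad i l
        + b.coord i x * (∑ m, β m * b.grad m l + a * b.grad i l) := by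
  have hd : ∀ m, HasFDerivAt (b.coord m) (fderiv ℝ (b.coord m) x) x := fun m =>
    ((b.contDiff_coord m).differentiable (by simp) x).hasFDerivAt
  have h1 := (hd i).mul ((HasFDerivAt.fun_sum fun m (_ : m ∈ Finset.univ) =>
    (hd m).const_mul (β m)).add ((hd i).const_mul a))
  have h2 := h1.fderiv
  unfold partialD
  simp only [Pi.add_apply] at h2
  erw [h2]
  simp [fderiv_coord_apply, grad]
  ring

lemma contDiff_ct_form (β : Fin 3 → ℝ) (a : ℝ) (i : Fin 3) :
    ContDiff ℝ ∞ (fun x => b.coord i x * (∑ m, β m * b.coord m x + a * b.coord i x)) := by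
  have h := b.contDiff_coord
  exact (h i).mul ((ContDiff.sum fun m _ => contDiff_const.mul (h m)).add
    (contDiff_const.mul (h i)))

/-- On each cell, the `L²` norm of a linear form in the barycentric coordinates controls its
coefficients. -/
lemma volume_mul_sq_coeff_le (i : Fin 3) (d : Fin 3 → ℝ) :
    volume.real (convexHull ℝ (Set.range b)) * ∑ m, d m ^ 2
      ≤ 1000000 * ∫ x in interior (b.ctCell i), (∑ m, d m * b.coord m x) ^ 2 := by
  obtain ⟨h1, h2, h3⟩ := ne_shift i
  have hn1 : ∀ q, (b.coord q).linear (b (i + 1) - b i)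
      = (if q = i + 1 then 1 else 0) - if q = i then 1 else 0 :=
    fun q => by rw [linear_coord_sub, coord_apply, coord_apply]
  have hn2 : ∀ q, (b.coord q).linear (b (i + 2) - b i)
      = (if q = i + 2 then 1 else 0) - if q = i then 1 else 0 :=
    fun q => by rw [linear_coord_sub, coord_apply, coord_apply]
  obtain ⟨L, hL⟩ := exists_chart (e := b (i + 1) - b i) (d := b (i + 2) - b i) (by
    intro s t h
    have e1 := congrArg (b.coord (i + 1)).linear h
    have e2 := congrArg (b.coord (i + 2)).linear h
    simp only [map_add, map_smul, hn1, hn2, map_zero, if_pos, if_neg h1.symm, if_neg h2,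
      if_neg h2.symm, if_neg h3.symm, smul_eq_mul] at e1 e2
    constructor <;> linarith)
  have hc : ∀ q y, b.coord q (affChart (b i) L y) = (if q = i then 1 else 0)
      + y.1 * ((if q = i + 1 then 1 else 0) - if q = i then 1 else 0)
      + y.2 * ((if q = i + 2 then 1 else 0) - if q = i then 1 else 0) := by
    intro q y
    rw [affChart_apply, hL, coord_add_apply, hn1, hn2, coord_apply]
  have hc0 : ∀ y, b.coord i (affChart (b i) L y) = 1 - y.1 - y.2 := fun y => by
    rw [hc]
    simp only [if_pos, if_neg h1, if_neg h3]
    ring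
  have hc1 : ∀ y, b.coord (i + 1) (affChart (b i) L y) = y.1 := fun y => by
    rw [hc]
    simp only [if_pos, if_neg h1.symm, if_neg h2]
    ring
  have hc2 : ∀ y, b.coord (i + 2) (affChart (b i) L y) = y.2 := fun y => by
    rw [hc]
    simp only [if_pos, if_neg h2.symm, if_neg h3.symm]
    ring
  set Ψ := affChart (b i) L with hΨ
  obtain ⟨c, -, hv⟩ := exists_map_affChart (b i) L
  set Q : Set (ℝ × ℝ) := Set.Ioo (2 / 5 : ℝ) (1 / 2) ×ˢ Set.Ioo (2 / 5 : ℝ) (1 / 2) with hQ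
  -- In the chart the triangle lies in the unit square, so its area is at most the Jacobian.
  have hvol : volume.real (convexHull ℝ (Set.range b)) ≤ c := by
    have hsub : Ψ ⁻¹' convexHull ℝ (Set.range b) ⊆ Set.Icc 0 1 ×ˢ Set.Icc 0 1 := by
      intro y hy
      rw [b.convexHull_eq_nonneg_coord] at hy
      have y0 := hy i
      have y1 := hy (i + 1)
      have y2 := hy (i + 2)
      rw [hc0] at y0
      rw [hc1] at y1
      rw [hc2] at y2
      exact ⟨⟨y1, by linarith⟩, ⟨y2, by linarith⟩⟩
    have hle : volume (convexHull ℝ (Set.range b)) ≤ c := by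
      rw [hv, Measure.smul_apply, Ψ.measurableEmbedding.map_apply]
      calc c • volume (Ψ ⁻¹' convexHull ℝ (Set.range b))
          ≤ c • volume (Set.Icc (0 : ℝ) 1 ×ˢ Set.Icc (0 : ℝ) 1) := by gcongr
        _ = c := by
          rw [Measure.volume_eq_prod, Measure.prod_prod, Real.volume_Icc]
          simp [ENNReal.smul_def]
    exact ENNReal.toReal_le_of_le_ofReal c.2 (by simpa using hle)
  have hint : (c : ℝ) * ∫ y in Q, (d i * (1 - y.1 - y.2) + d (i + 1) * y.1 + d (i + 2) * y.2) ^ 2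
      ≤ ∫ x in interior (b.ctCell i), (∑ m, d m * b.coord m x) ^ 2 := by
    have hcont : Continuous fun x => (∑ m, d m * b.coord m x) ^ 2 := by
      have := fun m => (b.contDiff_coord m).continuous
      fun_prop
    have hbdd : Bornology.IsBounded (interior (b.ctCell i)) :=
      ((isBounded_convexHull.2 (Set.finite_range b).isBounded).subset interior_subset).subset
        (b.interior_ctCell_subset i)
    have hio : IntegrableOn (fun x => (∑ m, d m * b.coord m x) ^ 2) (interior (b.ctCell i)) :=
      (hcont.continuousOn.integrableOn_compact hbdd.isCompact_closure).mono_set subset_closure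
    -- On the box the `i`-th coordinate lies in `(0, 1/5)`, while the other two exceed `2/5`.
    have hsub : Ψ '' Q ⊆ interior (b.ctCell i) := by
      rintro _ ⟨y, ⟨⟨s1, s2⟩, ⟨t1, t2⟩⟩, rfl⟩
      refine b.mem_interior_ctCell (by rw [hc0]; linarith) fun q hq => ?_
      rcases (eq_shift i q).resolve_left hq with rfl | rfl
      · rw [hc0, hc1]; linarith
      · rw [hc0, hc2]; linarith
    refine le_trans (le_of_eq ?_) (setIntegral_mono_set hio
      (Eventually.of_forall fun x => sq_nonneg _) hsub.eventuallyLE)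
    rw [hv, Measure.restrict_smul, integral_smul_nnreal_measure,
      Ψ.measurableEmbedding.setIntegral_map, Set.preimage_image_eq _ Ψ.injective]
    simp only [Fin.sum_eq_of_ne h1 h2 h3, hc0, hc1, hc2]
    rfl
  have hbox := sq_coeff_le_integral_box (d i) (d (i + 1)) (d (i + 2))
  rw [Fin.sum_eq_of_ne h1 h2 h3 (fun m => d m ^ 2)]
  rw [← hQ] at hbox
  have k1 := mul_le_mul_of_nonneg_left hbox c.2
  have k2 := mul_le_mul_of_nonneg_right hvol
    (add_nonneg (add_nonneg (sq_nonneg (d i)) (sq_nonneg (d (i + 1)))) (sq_nonneg (d (i + 2))))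
  simp only [NNReal.val_eq_coe] at k1
  linarith

end AffineBasis

namespace Affine.Simplex

/-- Edges at a nondegenerate angle times gradients of barycentric coordinates are bounded by the
aspect ratio. -/
lemma abs_edge_mul_grad_le (T : Affine.Triangle ℝ Plane) {k : Fin 3} {σ : ℝ} (hσ : 0 < σ)
    (hk : σ ≤ Real.sin
      (EuclideanGeometry.angle (T.points (k + 1)) (T.points k) (T.points (k + 2))))
    (p q : Fin 3) (c l : Fin 2) :
    |(T.planeBasis p - T.planeBasis k) c * T.planeBasis.grad q l| ≤ 2 * (aspectRatio T / σ) := by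
  set b := T.planeBasis with hb
  obtain ⟨h1, h2, h3⟩ := AffineBasis.ne_shift k
  set e := b (k + 1) - b k with he
  set d := b (k + 2) - b k with hd
  set ρ := aspectRatio T with hρ
  have hρ0 : 0 < ρ := T.aspectRatio_pos
  have dist_e : dist (T.points (k + 1)) (T.points k) = ‖e‖ := dist_eq_norm _ _
  have dist_d : dist (T.points (k + 2)) (T.points k) = ‖d‖ := dist_eq_norm _ _
  have dist_p : dist (T.points p) (T.points k) = ‖b p - b k‖ := dist_eq_norm _ _
  have he0 : 0 < ‖e‖ := by
    rw [← dist_e]; exact dist_pos.2 (T.independent.injective.ne h1.symm)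
  have hd0 : 0 < ‖d‖ := by
    rw [← dist_d]; exact dist_pos.2 (T.independent.injective.ne h3.symm)
  have hpe : ‖b p - b k‖ ≤ ρ * ‖e‖ := by
    rw [← dist_e, ← dist_p]; exact T.dist_le_aspectRatio_mul_dist h1.symm
  have hpd : ‖b p - b k‖ ≤ ρ * ‖d‖ := by
    rw [← dist_d, ← dist_p]; exact T.dist_le_aspectRatio_mul_dist h3.symm
  have hdet := sin_angle_mul_norm_eq_abs_det e d
  change Real.sin (EuclideanGeometry.angle (T.points (k + 1)) (T.points k) (T.points (k + 2))) * _
    = _ at hdet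
  set Δ := |e 0 * d 1 - e 1 * d 0| with hΔ
  have hΔσ : σ * (‖e‖ * ‖d‖) ≤ Δ := by
    rw [← hdet]
    exact mul_le_mul_of_nonneg_right hk (by positivity)
  have hΔ' : |d 0 * e 1 - d 1 * e 0| = Δ := by
    rw [hΔ, ← abs_neg]; congr 1; ring
  have hdual : ∀ (q : Fin 3) (w : Plane), ∑ c, b.grad q c * w c = (b.coord q).linear w := by
    intro q w
    rw [b.linear_coord_apply]
    exact Finset.sum_congr rfl fun _ _ => mul_comm _ _
  have g1 : |b.grad (k + 1) l| * Δ ≤ ‖d‖ := by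
    refine abs_dual_mul_det_le ?_ ?_ l <;>
      simp only [hdual, he, hd, b.linear_coord_sub, b.coord_apply, if_neg h1.symm, if_neg h2] <;> simp
  have g2 : |b.grad (k + 2) l| * Δ ≤ ‖e‖ := by
    rw [← hΔ']
    refine abs_dual_mul_det_le ?_ ?_ l <;>
      simp only [hdual, he, hd, b.linear_coord_sub, b.coord_apply, if_neg h3.symm, if_neg h2.symm] <;> simp
  have hed : 0 < ‖e‖ * ‖d‖ := by positivity
  -- The norm `f` of the edge opposite in Cramer's rule cancels against `Δ ≥ σ ‖e‖ ‖d‖`; the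
  -- quotient of two edge lengths that is left is at most `ρ`.
  have bound : ∀ (n : Fin 3) (f : ℝ), |b.grad n l| * Δ ≤ f → ‖b p - b k‖ * f ≤ ρ * (‖e‖ * ‖d‖) →
      |(b p - b k) c * b.grad n l| ≤ ρ / σ := by
    intro n f hn hf
    rw [abs_mul, le_div_iff₀ hσ]
    have a1 : |(b p - b k) c| * |b.grad n l| ≤ ‖b p - b k‖ * |b.grad n l| :=
      mul_le_mul_of_nonneg_right (abs_apply_le_norm _ _) (abs_nonneg _)
    have a2 : |b.grad n l| * (σ * (‖e‖ * ‖d‖)) ≤ f :=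
      (mul_le_mul_of_nonneg_left hΔσ (abs_nonneg _)).trans hn
    have a3 := (mul_le_mul_of_nonneg_left a2 (norm_nonneg (b p - b k))).trans hf
    have a4 := mul_le_mul_of_nonneg_right a1 hσ.le
    refine a4.trans (le_of_mul_le_mul_right ?_ hed)
    calc _ = ‖b p - b k‖ * (|b.grad n l| * (σ * (‖e‖ * ‖d‖))) := by ring
      _ ≤ _ := a3
  have b1 := bound (k + 1) ‖d‖ g1 (by
    calc _ ≤ ρ * ‖e‖ * ‖d‖ := mul_le_mul_of_nonneg_right hpe hd0.le
      _ = _ := by ring)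
  have b2 := bound (k + 2) ‖e‖ g2 (by
    calc _ ≤ ρ * ‖d‖ * ‖e‖ := mul_le_mul_of_nonneg_right hpd he0.le
      _ = _ := by ring)
  have hpos : 0 ≤ ρ / σ := by positivity
  rcases AffineBasis.eq_shift k q with rfl | rfl | rfl
  -- For `q = k` the gradient is minus the sum of the other two, which accounts for the factor 2.
  · have hs := b.sum_linear_coord (EuclideanSpace.single l 1)
    rw [Fin.sum_eq_of_ne h1 h2 h3] at hs
    have hg : b.grad q l = -b.grad (q + 1) l - b.grad (q + 2) l := by
      unfold AffineBasis.grad; linarith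
    rw [hg]
    rw [abs_le] at b1 b2 ⊢
    constructor <;> linarith [b1.1, b1.2, b2.1, b2.2]
  · linarith
  · linarith

end Affine.Simplex

/-! ### Gradient entries controlled by divergence coefficients -/

namespace AffineBasis

variable (b : AffineBasis (Fin 3) ℝ Plane)

/-- Coefficients, in the barycentric coordinates, of the divergence on the `i`-th cell. -/
noncomputable def divCoeff (β : Fin 2 → Fin 3 → ℝ) (a : Fin 2 → ℝ) (i m : Fin 3) : ℝ :=
  (∑ c, β c m * b.grad i c) +
    if m = i then 2 * (∑ c, a c * b.grad i c) + ∑ p, ∑ c, β c p * b.grad p c else 0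

/-- Entries of the gradient on the `i`-th cell. -/
noncomputable def gradEntry (β : Fin 2 → Fin 3 → ℝ) (a : Fin 2 → ℝ) (i : Fin 3) (c l : Fin 2)
    (x : Plane) : ℝ :=
  (∑ m, β c m * b.coord m x + a c * b.coord i x) * b.grad i l
    + b.coord i x * (∑ m, β c m * b.grad m l + a c * b.grad i l)

lemma sum_gradEntry (β : Fin 2 → Fin 3 → ℝ) (a : Fin 2 → ℝ) (i : Fin 3) (x : Plane) :
    ∑ c, b.gradEntry β a i c c x = ∑ m, b.divCoeff β a i m * b.coord m x := by
  obtain ⟨h1, h2, h3⟩ := ne_shift i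
  simp only [gradEntry, divCoeff, Fin.sum_univ_two, Fin.sum_eq_of_ne h1 h2 h3, if_pos,
    if_neg h1.symm, if_neg h3.symm]
  ring

/-- The divergence sees only the products of `β_m` and `a` with the gradients `∇λ_q`. Expanding
these vectors along the edges at `b k` recovers single components, at the price of `κ`. -/
lemma abs_gradEntry_le {k : Fin 3} {κ δ : ℝ} (β : Fin 2 → Fin 3 → ℝ) (a : Fin 2 → ℝ)
    (hκ : ∀ p q c l, |(b p - b k) c * b.grad q l| ≤ 2 * κ)
    (hδ : ∀ i m, |b.divCoeff β a i m| ≤ δ) (i : Fin 3) (c l : Fin 2) {x : Plane}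
    (hx : ∀ m, 0 ≤ b.coord m x) : |b.gradEntry β a i c l x| ≤ 88 * (κ * δ) := by
  have hsum : ∀ m, b.coord m x ≤ 1 := by
    intro m
    have := b.sum_coord x
    have := hx 0
    have := hx 1
    have := hx 2
    fin_cases m <;> simp <;> linarith
  have lin : ∀ (w : Fin 2 → ℝ) (q : Fin 3), ∑ c, w c * b.grad q c
      = (b.coord q).linear (WithLp.toLp 2 w) := fun w q => by
    rw [b.linear_coord_apply]
  obtain ⟨hC, hA⟩ := coeff_le_of_div_coeff_le
    (C := fun m q => ∑ c, β c m * b.grad q c) (A := fun q => ∑ c, a c * b.grad q c) (δ := δ)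
    (fun m => by
      have := b.sum_linear_coord (WithLp.toLp 2 fun c => β c m)
      rw [← this]
      exact Finset.sum_congr rfl fun q _ => lin (fun c => β c m) q) hδ
  have comp : ∀ (w : Fin 2 → ℝ) (M : ℝ), 0 ≤ M → (∀ q, |∑ c, w c * b.grad q c| ≤ M) →
      ∀ q, |w c * b.grad q l| ≤ 4 * M * κ := by
    intro w M hM hw q
    have e := congrArg (fun v : Plane => v c) (b.eq_edge_combination k (WithLp.toLp 2 w))
    simp only [PiLp.add_apply, PiLp.smul_apply, smul_eq_mul, ← lin] at e
    have t : ∀ r p, |(∑ c, w c * b.grad r c) * ((b p - b k) c * b.grad q l)| ≤ M * (2 * κ) := by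
      intro r p
      rw [abs_mul]
      exact mul_le_mul (hw r) (hκ p q c l) (abs_nonneg _) hM
    rw [e]
    calc _ = |(∑ c, w c * b.grad (k + 1) c) * ((b (k + 1) - b k) c * b.grad q l)
          + (∑ c, w c * b.grad (k + 2) c) * ((b (k + 2) - b k) c * b.grad q l)| := by
          congr 1; ring
      _ ≤ _ := abs_add_le _ _
      _ ≤ M * (2 * κ) + M * (2 * κ) := add_le_add (t _ _) (t _ _)
      _ = _ := by ring
  have hδ0 : 0 ≤ δ := (abs_nonneg _).trans (hδ 0 0)
  have B : ∀ m q, |β c m * b.grad q l| ≤ 8 * (κ * δ) := fun m q =>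
    (comp (fun c => β c m) (2 * δ) (by positivity) (hC m) q).trans (by linarith)
  have A := (comp a (5 * δ) (by positivity) hA i)
  have scale : ∀ {m : Fin 3} {y M : ℝ}, |y| ≤ M → |b.coord m x * y| ≤ M := by
    intro m y M hy
    rw [abs_mul, abs_of_nonneg (hx m)]
    calc _ ≤ 1 * |y| := mul_le_mul_of_nonneg_right (hsum m) (abs_nonneg _)
      _ ≤ M := by rw [one_mul]; exact hy
  -- Six terms in `β` of size at most `8 κ δ` and twice one term in `a` of size at most `20 κ δ` add
  -- up to `88 κ δ`.
  have e : b.gradEntry β a i c l x = (b.coord 0 x * (β c 0 * b.grad i l)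
      + b.coord 1 x * (β c 1 * b.grad i l) + b.coord 2 x * (β c 2 * b.grad i l))
      + 2 * (b.coord i x * (a c * b.grad i l))
      + (b.coord i x * (β c 0 * b.grad 0 l) + b.coord i x * (β c 1 * b.grad 1 l)
        + b.coord i x * (β c 2 * b.grad 2 l)) := by
    simp only [gradEntry, Fin.sum_univ_three]
    ring
  have t1 := abs_le.1 (scale (m := 0) (B 0 i))
  have t2 := abs_le.1 (scale (m := 1) (B 1 i))
  have t3 := abs_le.1 (scale (m := 2) (B 2 i))
  have t4 := abs_le.1 (scale (m := i) A)
  have t5 := abs_le.1 (scale (m := i) (B 0 0))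
  have t6 := abs_le.1 (scale (m := i) (B 1 1))
  have t7 := abs_le.1 (scale (m := i) (B 2 2))
  rw [e, abs_le]
  constructor <;> linarith [t1.1, t1.2, t2.1, t2.2, t3.1, t3.2, t4.1, t4.2, t5.1, t5.2, t6.1, t6.2,
    t7.1, t7.2]

end AffineBasis

/-! ### The `L²` estimate and the theorem -/

/-- The a priori bound for a field whose gradient is the piecewise one. -/
lemma integral_grad_sq_le (b : AffineBasis (Fin 3) ℝ Plane) {k : Fin 3} {κ : ℝ}
    (hκ : ∀ p q c l, |(b p - b k) c * b.grad q l| ≤ 2 * κ)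
    {β : Fin 2 → Fin 3 → ℝ} {a : Fin 2 → ℝ} {G : Fin 2 → Fin 2 → Plane → ℝ}
    (hGm : ∀ c l, AEStronglyMeasurable (G c l) (volume.restrict (convexHull ℝ (Set.range b))))
    (hG : ∀ i c l, ∀ᵐ x, x ∈ interior (b.ctCell i) → G c l x = b.gradEntry β a i c l x) :
    ∫ x in convexHull ℝ (Set.range b), ∑ i, ∑ j, G i j x ^ 2 ≤
      (400000 * κ) ^ 2 * ∫ x in convexHull ℝ (Set.range b), (∑ i, G i i x) ^ 2 := by
  set T := convexHull ℝ (Set.range b) with hT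
  have hTc : IsCompact T := (Set.finite_range b).isCompact_convexHull ℝ
  have hTm : MeasurableSet T := hTc.measurableSet
  have hTfin : volume T < ⊤ := hTc.measure_lt_top
  -- `√S` serves as the uniform bound on the divergence coefficients, so the sup bound on the
  -- gradient and the `L²` bound on the divergence meet in the quantity `volume T * S`.
  set S := ∑ i, ∑ m, b.divCoeff β a i m ^ 2 with hS
  have hS0 : 0 ≤ S := Finset.sum_nonneg fun i _ => Finset.sum_nonneg fun m _ => sq_nonneg _
  have hdiv : ∀ i m, |b.divCoeff β a i m| ≤ √S := by
    intro i m
    refine Real.abs_le_sqrt ?_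
    calc _ ≤ ∑ m, b.divCoeff β a i m ^ 2 :=
          Finset.single_le_sum (f := fun m => b.divCoeff β a i m ^ 2)
            (fun m _ => sq_nonneg _) (Finset.mem_univ m)
      _ ≤ _ := Finset.single_le_sum (f := fun i => ∑ m, b.divCoeff β a i m ^ 2)
            (fun i _ => Finset.sum_nonneg fun m _ => sq_nonneg _) (Finset.mem_univ i)
  have hsq : ∀ᵐ x, x ∈ T → ∀ c l, G c l x ^ 2 ≤ 88 ^ 2 * κ ^ 2 * S := by
    filter_upwards [b.ae_mem_interior_ctCell, ae_all_iff.2 fun i => ae_all_iff.2 fun c =>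
      ae_all_iff.2 fun l => hG i c l] with x h1 h2 hx c l
    obtain ⟨i, hi⟩ := h1 hx
    rw [hT, b.convexHull_eq_nonneg_coord] at hx
    have h3 := b.abs_gradEntry_le β a hκ hdiv i c l hx
    rw [h2 i c l hi]
    calc b.gradEntry β a i c l x ^ 2 ≤ (88 * (κ * √S)) ^ 2 := sq_le_sq' (abs_le.1 h3).1 (abs_le.1 h3).2
      _ = 88 ^ 2 * κ ^ 2 * √S ^ 2 := by ring
      _ = _ := by rw [Real.sq_sqrt hS0]
  have upper : ∫ x in T, ∑ i, ∑ j, G i j x ^ 2 ≤ 4 * (88 ^ 2 * κ ^ 2 * S) * volume.real T := by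
    refine (Real.le_norm_self _).trans (norm_setIntegral_le_of_norm_le_const_ae hTfin ((ae_restrict_iff' hTm).2 ?_))
    filter_upwards [hsq] with x hx hxT
    have h := hx hxT
    rw [Real.norm_of_nonneg (Finset.sum_nonneg fun i _ => Finset.sum_nonneg fun j _ => sq_nonneg _)]
    simp only [Fin.sum_univ_two]
    linarith [h 0 0, h 0 1, h 1 0, h 1 1]
  have hint : IntegrableOn (fun x => (∑ i, G i i x) ^ 2) T := by
    have : IsFiniteMeasure (volume.restrict T) := ⟨by simpa using hTfin⟩
    refine Integrable.of_bound (C := 4 * (88 ^ 2 * κ ^ 2 * S)) ?_ ?_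
    · simp only [Fin.sum_univ_two]
      exact ((hGm 0 0).add (hGm 1 1)).pow 2
    · rw [ae_restrict_iff' hTm]
      filter_upwards [hsq] with x hx hxT
      have h := hx hxT
      rw [Real.norm_of_nonneg (sq_nonneg _), Fin.sum_univ_two]
      nlinarith [h 0 0, h 1 1, sq_nonneg (G 0 0 x - G 1 1 x)]
  have lower : ∀ i, volume.real T * ∑ m, b.divCoeff β a i m ^ 2
      ≤ 1000000 * ∫ x in T, (∑ i, G i i x) ^ 2 := by
    intro i
    refine (b.volume_mul_sq_coeff_le i _).trans (mul_le_mul_of_nonneg_left ?_ (by norm_num))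
    have hcell : ∫ x in interior (b.ctCell i), (∑ m, b.divCoeff β a i m * b.coord m x) ^ 2
        = ∫ x in interior (b.ctCell i), (∑ i, G i i x) ^ 2 := by
      refine setIntegral_congr_ae isOpen_interior.measurableSet ?_
      filter_upwards [ae_all_iff.2 fun c => hG i c c] with x hx hxi
      rw [← b.sum_gradEntry, Finset.sum_congr rfl fun c _ => hx c hxi]
    rw [hcell]
    exact setIntegral_mono_set hint (Eventually.of_forall fun x => sq_nonneg _)
      ((b.interior_ctCell_subset i).trans interior_subset).eventuallyLE
  have l0 := lower 0
  have l1 := lower 1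
  have l2 := lower 2
  have hsum : volume.real T * S ≤ 3000000 * ∫ x in T, (∑ i, G i i x) ^ 2 := by
    rw [hS, Fin.sum_univ_three]
    linarith
  have hI : 0 ≤ ∫ x in T, (∑ i, G i i x) ^ 2 := integral_nonneg fun x => sq_nonneg _
  calc _ ≤ 4 * (88 ^ 2 * κ ^ 2 * S) * volume.real T := upper
    _ = 4 * 88 ^ 2 * κ ^ 2 * (volume.real T * S) := by ring
    _ ≤ 4 * 88 ^ 2 * κ ^ 2 * (3000000 * ∫ x in T, (∑ i, G i i x) ^ 2) := by gcongr
    -- Numerically, `4 * 88² * 3000000 ≤ 400000²`.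
    _ ≤ _ := by nlinarith [mul_nonneg (sq_nonneg κ) hI]

theorem mainTheorem4 (δ : ℝ) (hδ : 0 < δ) :
    ∃ C : ℝ, 0 < C ∧ ∀ T : Affine.Triangle ℝ Plane, LargeAngleCond δ T →
      ∀ v ∈ pwPolyZero 2 (cloughTocher T T.centroid),
      ∀ G : Fin 2 → Fin 2 → Plane → ℝ,
        IsWeakGradient (meshDomain (cloughTocher T T.centroid)) v G →
        gradL2Norm T.closedInterior G ≤
          C * aspectRatio T * divL2Norm T.closedInterior G := by
  set σ := Real.sin (min δ (Real.pi / 3)) with hσ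
  have hσ0 : 0 < σ := by
    have hpi := Real.pi_pos
    refine Real.sin_pos_of_pos_of_lt_pi (lt_min hδ (by positivity)) ?_
    exact lt_of_le_of_lt (min_le_right _ _) (by linarith)
  refine ⟨400000 / σ, by positivity, fun T hT v hv G hG => ?_⟩
  obtain ⟨k, hk⟩ := T.exists_sin_angle_ge hδ hT
  have hform : ∀ c : Fin 2, _ := fun c => T.exists_ct_form_of_memH10 (hv c).1 (hv c).2
  choose β a hβ using hform
  set b := T.planeBasis with hb
  rw [T.meshDomain_cloughTocher, ← hb] at hG
  have hGcell : ∀ i c l, ∀ᵐ x, x ∈ interior (b.ctCell i) → G c l x = b.gradEntry β a i c l x := by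
    intro i c l
    filter_upwards [(hG c l).ae_eq_partialD isOpen_interior (b.interior_ctCell_subset i)
      (b.contDiff_ct_form (β c) (a c) i) (hβ c i)] with x hx hxi
    rw [hx hxi, b.partialD_ct_form]
    rfl
  have hGm : ∀ c l, AEStronglyMeasurable (G c l)
      (volume.restrict (convexHull ℝ (Set.range b))) := by
    intro c l
    -- The weak gradient is given on the open domain while the norms are taken on the closed
    -- triangle; the boundary of a convex set is null.
    have hae : interior (convexHull ℝ (Set.range b)) =ᵐ[volume] convexHull ℝ (Set.range b) :=
      interior_ae_eq_of_null_frontier ((convex_convexHull ℝ _).addHaar_frontier volume)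
    rw [← Measure.restrict_congr_set hae]
    exact (hG c l).2.1.aestronglyMeasurable
  have hmain := integral_grad_sq_le b (T.abs_edge_mul_grad_le hσ0 hk) hGm hGcell
  have hρ := T.aspectRatio_pos
  rw [gradL2Norm, divL2Norm, T.closedInterior_eq_convexHull_planeBasis]
  refine (Real.sqrt_le_sqrt hmain).trans (le_of_eq ?_)
  rw [Real.sqrt_mul (sq_nonneg _), Real.sqrt_sq (by positivity)]
  ring
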